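/- Throughout, an ordered semigroup is a commutative monoid $(S,+,0)$ with a translation-invariant partial order for which $0$ is the smallest element. For $s,t\in S$ write $s\ll t$ if for every increasing sequence $(t_n)$ in $S$ that has a supremum with $t\le\sup_n t_n$ there is $n_0$ with $s\le t_{n_0}$. A sequence $(s_n)$ is rapidly increasing if $s_n\ll s_{n+1}$ for all $n$. A subset $S'\subseteq S$ is dense if every element of $S$ is the supremum of a rapidly increasing sequence of elements of $S'$. Consider the following axioms. (O1) Every increasing sequence in $S$ has a supremum. (O2) Every $s\in S$ is the supremum of a rapidly increasing sequence. (O3) If $s_1\ll t_1$ and $s_2\ll t_2$, then $s_1+s_2\ll t_1+t_2$. (O4) If $(s_n)$ and $(t_n)$ are increasing sequences, then $\sup_n(s_n+t_n)=\sup_n s_n+\sup_n t_n$. (O5) If $s'\ll s\le t$, then there is $r\in S$ such that $s'+r\le t\le s+r$. (O6) If $s\le r+t$ and $s'\ll s$, then there are $r',t'\in S$ such that $s'\le r'+t'$, $r'\le r$, $r'\le s$, $t'\le t$ and $t'\le s$. A functional on $S$ is a map $\lambda\colon S\to[0,\infty]$ that is additive, order preserving, satisfies $\lambda(0)=0$,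 and preserves suprema of increasing sequences; $\mathrm F(S)$ denotes the set of all functionals on $S$. For $s\in S$ let $\hat s\colon \mathrm F(S)\to[0,\infty]$, $\hat s(\lambda)=\lambda(s)$. The realification $S_{\mathbb R}$ is the set of all functions $f\colon \mathrm F(S)\to[0,\infty]$ for which there are $s_i\in S$ and positive integers $n_i$ ($i=1,2,\dots$) such that the sequence $(\hat s_i/n_i)_i$ is pointwise increasing and $f(\lambda)=\sup_i \hat s_i(\lambda)/n_i$ for all $\lambda\in \mathrm F(S)$. It is an ordered semigroup under pointwise addition and the pointwise order. Theorem 4.4. Let $S$ be an ordered semigroup that satisfies (O1)-(O6) and has a countable dense subset. (i) Any two elements $f,g\in S_{\mathbb R}$ have a greatest lower bound $f\wedge g$ in $S_{\mathbb R}$. (ii) For every $f\in S_{\mathbb R}$ and every increasing sequence $(g_n)$ in $S_{\mathbb R}$, the suprema $\sup_n g_n$ and $\sup_n (f\wedge g_n)$ exist in $S_{\mathbb R}$, and $$\sup_n (f\wedge g_n)=f\wedge \bigl(\sup_n g_n\bigr).$$ (iii) For all $f,g,h\in S_{\mathbb R}$, $$(f\wedge g)+h=(f+h)\wedge(g+h).$$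 -/

import Mathlib

open scoped ENNReal

namespace CuSemigroup

section Axioms

variable {S : Type*} [AddCommMonoid S] [PartialOrder S]

/-- Sequential compact containment `s ≪ t`: whenever `(u n)` is an increasing sequence with a
supremum `x` and `t ≤ x`, some `u n` is already above `s`. -/
def WayBelow (s t : S) : Prop :=
  ∀ (u : ℕ → S) (x : S), Monotone u → IsLUB (Set.range u) x → t ≤ x → ∃ n, s ≤ u n

/-- A rapidly increasing sequence: each term is compactly contained in the next one. -/
def RapidlyIncreasing (u : ℕ → S) : Prop :=
  ∀ n, WayBelow (u n) (u (n + 1))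

/-- A subset is dense if every element is the supremum of a rapidly increasing sequence of
elements of the subset. -/
def IsDense (D : Set S) : Prop :=
  ∀ s : S, ∃ u : ℕ → S, (∀ n, u n ∈ D) ∧ RapidlyIncreasing u ∧ IsLUB (Set.range u) s

variable (S)

/-- O1: every increasing sequence has a supremum. -/
def AxiomO1 : Prop :=
  ∀ u : ℕ → S, Monotone u → ∃ s, IsLUB (Set.range u) s

/-- O2: every element is the supremum of a rapidly increasing sequence. -/
def AxiomO2 : Prop :=
  ∀ s : S, ∃ u : ℕ → S, RapidlyIncreasing u ∧ IsLUB (Set.range u) s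

/-- O3: addition preserves compact containment. -/
def AxiomO3 : Prop :=
  ∀ s₁ t₁ s₂ t₂ : S, WayBelow s₁ t₁ → WayBelow s₂ t₂ → WayBelow (s₁ + s₂) (t₁ + t₂)

/-- O4: addition is compatible with suprema of increasing sequences. -/
def AxiomO4 : Prop :=
  ∀ (u v : ℕ → S) (s t : S), Monotone u → Monotone v →
    IsLUB (Set.range u) s → IsLUB (Set.range v) t →
    IsLUB (Set.range fun n => u n + v n) (s + t)

/-- O5: almost algebraic order. -/
def AxiomO5 : Prop :=
  ∀ s' s t : S, WayBelow s' s → s ≤ t → ∃ r, s' + r ≤ t ∧ t ≤ s + r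

/-- O6: weak Riesz decomposition. -/
def AxiomO6 : Prop :=
  ∀ s r t : S, s ≤ r + t → ∀ s' : S, WayBelow s' s →
    ∃ r' t' : S, s' ≤ r' + t' ∧ (r' ≤ r ∧ r' ≤ s) ∧ (t' ≤ t ∧ t' ≤ s)

end Axioms

section Realification

variable (S : Type*) [AddCommMonoid S] [PartialOrder S]

/-- A functional on `S`: a map `S → [0,∞]` that is additive, order preserving, maps `0` to `0`
and preserves suprema of increasing sequences. -/
structure Functional extends S →+o ℝ≥0∞ where
  map_isLUB' : ∀ (u : ℕ → S) (s : S), Monotone u → IsLUB (Set.range u) s →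
    IsLUB (Set.range fun n => toFun (u n)) (toFun s)

variable {S}

/-- The function `λ ↦ λ(s)` on the cone of functionals that is induced by `s`. -/
def hat (s : S) : Functional S → ℝ≥0∞ :=
  fun l => l.toOrderAddMonoidHom s

/-- `f` is the pointwise supremum of an increasing sequence of functions of the form `ŝ / n`,
with `s ∈ S` and `n` a positive integer. -/
def IsRealified (f : Functional S → ℝ≥0∞) : Prop :=
  ∃ (s : ℕ → S) (n : ℕ → ℕ), (∀ i, 0 < n i) ∧
    (Monotone fun i => fun l : Functional S => hat (s i) l / (n i : ℝ≥0∞)) ∧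
    ∀ l : Functional S, f l = ⨆ i, hat (s i) l / (n i : ℝ≥0∞)

theorem hat_zero (l : Functional S) : hat (0 : S) l = 0 :=
  map_zero l.toOrderAddMonoidHom

theorem hat_add (s t : S) (l : Functional S) : hat (s + t) l = hat s l + hat t l :=
  map_add l.toOrderAddMonoidHom s t

theorem hat_nsmul (m : ℕ) (s : S) (l : Functional S) : hat (m • s) l = (m : ℝ≥0∞) * hat s l := by
  have h := map_nsmul l.toOrderAddMonoidHom m s
  rw [nsmul_eq_mul] at h
  exact h

theorem isRealified_zero : IsRealified (0 : Functional S → ℝ≥0∞) :=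
  ⟨fun _ => 0, fun _ => 1, fun _ => one_pos, fun _ _ _ => le_rfl, fun l => by simp [hat_zero]⟩

theorem IsRealified.add {f g : Functional S → ℝ≥0∞} (hf : IsRealified f) (hg : IsRealified g) :
    IsRealified (f + g) := by
  obtain ⟨s, n, hn, hs, hfs⟩ := hf
  obtain ⟨t, m, hm, ht, hgt⟩ := hg
  have key : ∀ i (l : Functional S),
      hat (m i • s i + n i • t i) l / ((n i * m i : ℕ) : ℝ≥0∞)
        = hat (s i) l / (n i : ℝ≥0∞) + hat (t i) l / (m i : ℝ≥0∞) := by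
    intro i l
    have hn0 : (n i : ℝ≥0∞) ≠ 0 := by exact_mod_cast (hn i).ne'
    have hm0 : (m i : ℝ≥0∞) ≠ 0 := by exact_mod_cast (hm i).ne'
    rw [hat_add, hat_nsmul, hat_nsmul, ENNReal.add_div, Nat.cast_mul,
      ENNReal.mul_div_mul_left _ _ hn0 (ENNReal.natCast_ne_top _), mul_comm (n i : ℝ≥0∞) (m i),
      ENNReal.mul_div_mul_left _ _ hm0 (ENNReal.natCast_ne_top _)]
  refine ⟨fun i => m i • s i + n i • t i, fun i => n i * m i,
    fun i => Nat.mul_pos (hn i) (hm i), ?_, ?_⟩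
  · intro i j hij l
    simp only [key]
    exact add_le_add (hs hij l) (ht hij l)
  · intro l
    simp only [key, Pi.add_apply]
    rw [hfs, hgt, ENNReal.iSup_add_iSup_of_monotone (fun i j hij => hs hij l)
      (fun i j hij => ht hij l)]

variable (S)

/-- The realification of `S`: all functions on the cone of functionals that are pointwise suprema
of increasing sequences of functions `ŝ / n`, with pointwise addition and pointwise order (as a
submonoid it inherits both). Such functions are automatically linear, and lower semicontinuous for
every topology on the cone of functionals for which all the `ŝ` are lower semicontinuous. -/
noncomputable def Realification : AddSubmonoid (Functional S → ℝ≥0∞) where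
  carrier := {f | IsRealified f}
  zero_mem' := isRealified_zero
  add_mem' := IsRealified.add

end Realification

end CuSemigroup

open Filter Topology

namespace CuSemigroup

section WayBelow

variable {S : Type*} [PartialOrder S]

theorem WayBelow.le {s t : S} (h : WayBelow s t) : s ≤ t := by
  obtain ⟨_, hn⟩ := h (fun _ => t) t monotone_const (by simp) le_rfl
  exact hn

theorem WayBelow.mono {s₀ s t t₀ : S} (h : WayBelow s t) (hs : s₀ ≤ s) (ht : t ≤ t₀) :
    WayBelow s₀ t₀ := fun u x hu hx htx => by
  obtain ⟨n, hn⟩ := h u x hu hx (ht.trans htx)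
  exact ⟨n, hs.trans hn⟩

theorem RapidlyIncreasing.monotone {u : ℕ → S} (hu : RapidlyIncreasing u) : Monotone u :=
  monotone_nat_of_le_succ fun n => (hu n).le

theorem RapidlyIncreasing.wayBelow {u : ℕ → S} (hu : RapidlyIncreasing u) {s : S}
    (hs : IsLUB (Set.range u) s) (n : ℕ) : WayBelow (u n) s :=
  (hu n).mono le_rfl (hs.1 ⟨n + 1, rfl⟩)

theorem WayBelow.exists_between (h2 : AxiomO2 S) {s t : S} (h : WayBelow s t) :
    ∃ r, WayBelow s r ∧ WayBelow r t := by
  obtain ⟨u, hu, hut⟩ := h2 t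
  obtain ⟨n, hn⟩ := h u t hu.monotone hut le_rfl
  exact ⟨u (n + 1), (hu n).mono hn le_rfl, hu.wayBelow hut _⟩

variable [AddCommMonoid S]

theorem wayBelow_zero (hpos : ∀ s : S, 0 ≤ s) (t : S) : WayBelow 0 t :=
  fun _ _ _ _ _ => ⟨0, hpos _⟩

theorem WayBelow.nsmul (hpos : ∀ s : S, 0 ≤ s) (h3 : AxiomO3 S) {s t : S} (h : WayBelow s t)
    (n : ℕ) : WayBelow (n • s) (n • t) := by
  induction n with
  | zero => simpa using wayBelow_zero hpos 0
  | succ n ih => simpa [succ_nsmul] using h3 _ _ _ _ ih h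

end WayBelow

section Functionals

variable {S : Type*} [AddCommMonoid S] [PartialOrder S]

theorem hat_mono {s t : S} (h : s ≤ t) (l : Functional S) : hat s l ≤ hat t l :=
  l.toOrderAddMonoidHom.monotone' h

/-- The largest functional below a monotone additive map `S → [0,∞]`. -/
noncomputable def regularize [IsOrderedAddMonoid S] (hpos : ∀ s : S, 0 ≤ s) (h2 : AxiomO2 S)
    (h3 : AxiomO3 S) (h4 : AxiomO4 S) (l : S →+o ℝ≥0∞) : Functional S where
  toFun s := ⨆ (s' : S) (_ : WayBelow s' s), l s'
  map_zero' := by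
    refine le_antisymm (iSup₂_le fun s' h => ?_) zero_le
    simpa using OrderHomClass.mono l h.le
  map_add' s t := by
    refine le_antisymm (iSup₂_le fun x hx => ?_) ?_
    · obtain ⟨u, hu, hus⟩ := h2 s
      obtain ⟨v, hv, hvt⟩ := h2 t
      obtain ⟨n, hn⟩ := hx _ _ (hu.monotone.add hv.monotone)
        (h4 u v s t hu.monotone hv.monotone hus hvt) le_rfl
      calc l x ≤ l (u n + v n) := OrderHomClass.mono l hn
        _ = l (u n) + l (v n) := map_add l _ _
        _ ≤ _ := add_le_add (le_iSup₂_of_le (u n) (hu.wayBelow hus n) le_rfl)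
          (le_iSup₂_of_le (v n) (hv.wayBelow hvt n) le_rfl)
    · refine ENNReal.biSup_add_biSup_le' (p := fun x => WayBelow x s)
        (q := fun x => WayBelow x t) (f := fun x => l x) (g := fun x => l x)
        ⟨0, wayBelow_zero hpos _⟩ ⟨0, wayBelow_zero hpos _⟩ ?_
      intro x hx y hy
      rw [← map_add l]
      exact le_iSup₂_of_le (x + y) (h3 _ _ _ _ hx hy) le_rfl
  monotone' s t hst := iSup₂_le fun x hx => le_iSup₂_of_le x (hx.mono le_rfl hst) le_rfl
  map_isLUB' u s hu hs := by
    refine ⟨?_, fun b hb => iSup₂_le fun x hx => ?_⟩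
    · rintro _ ⟨n, rfl⟩
      exact iSup₂_le fun x hx => le_iSup₂_of_le x (hx.mono le_rfl (hs.1 ⟨n, rfl⟩)) le_rfl
    · obtain ⟨y, hxy, hy⟩ := hx.exists_between h2
      obtain ⟨n, hn⟩ := hy u s hu hs le_rfl
      exact (le_iSup₂_of_le (f := fun (s' : S) (_ : WayBelow s' (u n)) => l s') x
        (hxy.mono le_rfl hn) le_rfl).trans (hb ⟨n, rfl⟩)

theorem le_hat_regularize [IsOrderedAddMonoid S] (hpos : ∀ s : S, 0 ≤ s) (h2 : AxiomO2 S)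
    (h3 : AxiomO3 S) (h4 : AxiomO4 S) (l : S →+o ℝ≥0∞) {s t : S} (h : WayBelow s t) :
    l s ≤ hat t (regularize hpos h2 h3 h4 l) :=
  le_iSup₂_of_le (f := fun (s' : S) (_ : WayBelow s' t) => l s') s h le_rfl

theorem hat_regularize_le [IsOrderedAddMonoid S] (hpos : ∀ s : S, 0 ≤ s) (h2 : AxiomO2 S)
    (h3 : AxiomO3 S) (h4 : AxiomO4 S) (l : S →+o ℝ≥0∞) (s : S) :
    hat s (regularize hpos h2 h3 h4 l) ≤ l s :=
  iSup₂_le fun _ hx => OrderHomClass.mono l hx.le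

/-- Multiplication of a functional by a scalar. -/
noncomputable def Functional.scale (c : ℝ≥0∞) (l : Functional S) : Functional S where
  toFun s := c * hat s l
  map_zero' := by simp [hat_zero]
  map_add' s t := by rw [hat_add, mul_add]
  monotone' s t hst := mul_le_mul_right (hat_mono hst l) c
  map_isLUB' u s hu hs := by
    have h : IsLUB (Set.range fun n => hat (u n) l) (hat s l) := l.map_isLUB' u s hu hs
    have h' : (c * hat s l) = ⨆ n, c * hat (u n) l := by rw [← h.iSup_eq, ENNReal.mul_iSup]
    exact h' ▸ isLUB_iSup

theorem hat_scale (c : ℝ≥0∞) (l : Functional S) (s : S) : hat s (l.scale c) = c * hat s l := rfl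

theorem IsRealified.scale {f : Functional S → ℝ≥0∞} (hf : IsRealified f) (c : ℝ≥0∞)
    (l : Functional S) : f (l.scale c) = c * f l := by
  obtain ⟨s, n, -, -, h⟩ := hf
  simp only [h, hat_scale, ENNReal.mul_iSup, mul_div_assoc]

/-- The pointwise limit of a sequence of functionals along an ultrafilter. -/
theorem exists_ultrafilter_limit (U : Ultrafilter ℕ) (l : ℕ → Functional S) :
    ∃ m : S →+o ℝ≥0∞, ∀ s, Tendsto (fun n => hat s (l n)) U (𝓝 (m s)) := by
  have ht : ∀ s, Tendsto (fun n => hat s (l n)) U (𝓝 (U.map fun n => hat s (l n)).lim) :=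
    fun s => (U.map fun n => hat s (l n)).le_nhds_lim
  refine ⟨⟨⟨⟨fun s => (U.map fun n => hat s (l n)).lim, ?_⟩, ?_⟩, ?_⟩, ht⟩
  · refine tendsto_nhds_unique (ht 0) ?_
    simp only [hat_zero]
    exact tendsto_const_nhds
  · intro s t
    refine tendsto_nhds_unique (ht (s + t)) ?_
    simp only [hat_add]
    exact (ht s).add (ht t)
  · intro s t hst
    exact le_of_tendsto_of_tendsto' (ht s) (ht t) fun n => hat_mono hst (l n)

end Functionals

section States

variable {S : Type*} [AddCommMonoid S] [PartialOrder S]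

/-- Monotone sublinear maps `S → [0,∞]` that grow by at least one under translation by `a`. -/
structure IsSublinear (a : S) (p : S → ℝ≥0∞) : Prop where
  mono : Monotone p
  map_zero : p 0 = 0
  add_le : ∀ x y, p (x + y) ≤ p x + p y
  le_nsmul : ∀ (n : ℕ) x, n * p x ≤ p (n • x)
  add_one_le : ∀ x, p x + 1 ≤ p (x + a)

theorem map_nsmul_le {S : Type*} [AddCommMonoid S] {p : S → ℝ≥0∞} (h0 : p 0 = 0)
    (hadd : ∀ x y, p (x + y) ≤ p x + p y)
    (n : ℕ) (x : S) : p (n • x) ≤ n * p x := by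
  induction n with
  | zero => simp [h0]
  | succ n ih =>
    rw [succ_nsmul, Nat.cast_succ, add_mul, one_mul]
    exact (hadd _ _).trans (add_le_add_left ih _)

/-- The modification of a sublinear map that makes it additive in the direction of `y`. -/
noncomputable def relax {S : Type*} [AddCommMonoid S] (p : S → ℝ≥0∞) (y : S) : S → ℝ≥0∞ :=
  fun x => ⨅ n : ℕ, (p (x + n • y) - n * p y)

theorem relax_le {S : Type*} [AddCommMonoid S] (p : S → ℝ≥0∞) (y x : S) : relax p y x ≤ p x :=
  (iInf_le _ 0).trans (by simp)

variable [IsOrderedAddMonoid S]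

theorem relax_add_le (hpos : ∀ s : S, 0 ≤ s) {p : S → ℝ≥0∞} (hm : Monotone p)
    (hn : ∀ (n : ℕ) x, n * p x ≤ p (n • x))
    (y x : S) (n : ℕ) : relax p y x + n * p y ≤ p (x + n • y) := by
  have h : relax p y x ≤ p (x + n • y) - n * p y := iInf_le _ n
  refine (add_le_add_left h _).trans ?_
  rw [tsub_add_cancel_of_le]
  exact (hn n y).trans (hm (le_add_of_nonneg_left (hpos x)))

theorem relax_properties (hpos : ∀ s : S, 0 ≤ s) {p : S → ℝ≥0∞} (hm : Monotone p) (h0 : p 0 = 0)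
    (hadd : ∀ x y, p (x + y) ≤ p x + p y) (hn : ∀ (n : ℕ) x, n * p x ≤ p (n • x))
    (y : S) (hy : p y ≠ ⊤) :
    Monotone (relax p y) ∧ relax p y 0 = 0 ∧
      (∀ x z, relax p y (x + z) ≤ relax p y x + relax p y z) ∧
      (∀ (n : ℕ) x, n * relax p y x ≤ relax p y (n • x)) ∧
      ∀ x, relax p y x + p y ≤ relax p y (x + y) := by
  have hfin : ∀ n : ℕ, (n : ℝ≥0∞) * p y ≠ ⊤ := fun n =>
    ENNReal.mul_ne_top (ENNReal.natCast_ne_top n) hy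
  refine ⟨fun x z hxz => iInf_mono fun n => tsub_le_tsub_right (hm (add_le_add_left hxz _)) _,
    le_antisymm (h0 ▸ relax_le p y 0) zero_le, ?_, ?_, ?_⟩
  · intro x z
    unfold relax
    rw [ENNReal.iInf_add]
    refine le_iInf fun n => ?_
    rw [ENNReal.add_iInf]
    refine le_iInf fun m => (iInf_le _ (n + m)).trans ?_
    rw [tsub_le_iff_right]
    calc p (x + z + (n + m) • y) = p ((x + n • y) + (z + m • y)) := by
            rw [add_nsmul, add_add_add_comm]
      _ ≤ p (x + n • y) + p (z + m • y) := hadd _ _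
      _ ≤ (p (x + n • y) - n * p y + n * p y) + (p (z + m • y) - m * p y + m * p y) :=
            add_le_add le_tsub_add le_tsub_add
      _ = _ := by push_cast; ring
  · intro n x
    rcases Nat.eq_zero_or_pos n with rfl | hn0
    · simp
    refine le_iInf fun m => ENNReal.le_sub_of_add_le_right (hfin m) ?_
    obtain ⟨j, hj⟩ : ∃ j, n * m = m + j := ⟨n * m - m, by
      have := Nat.le_mul_of_pos_left m hn0; omega⟩
    have hj' : (n : ℝ≥0∞) * m = m + j := by exact_mod_cast hj
    have key : (n * relax p y x + m * p y) + j * p y ≤ p (n • x + m • y) + j * p y := by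
      calc (n * relax p y x + m * p y) + j * p y
          = n * (relax p y x + m * p y) := by
            rw [mul_add, ← mul_assoc, hj']; ring
        _ ≤ n * p (x + m • y) := by gcongr; exact relax_add_le hpos hm hn y x m
        _ ≤ p (n • (x + m • y)) := hn _ _
        _ = p ((n • x + m • y) + j • y) := by
            rw [nsmul_add, ← mul_nsmul', hj, add_nsmul, add_assoc]
        _ ≤ p (n • x + m • y) + p (j • y) := hadd _ _
        _ ≤ _ := by gcongr; exact map_nsmul_le h0 hadd j y
    exact (ENNReal.add_le_add_iff_right (hfin j)).1 key
  · intro x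
    refine le_iInf fun n => ENNReal.le_sub_of_add_le_right (hfin n) ?_
    have h := relax_add_le hpos hm hn y x (n + 1)
    calc relax p y x + p y + n * p y = relax p y x + (n + 1 : ℕ) * p y := by push_cast; ring
      _ ≤ p (x + (n + 1) • y) := h
      _ = _ := by rw [succ_nsmul', add_assoc]

theorem IsSublinear.relax (hpos : ∀ s : S, 0 ≤ s) {a : S} {p : S → ℝ≥0∞}
    (hp : IsSublinear a p) {y : S} (hy : p y ≠ ⊤) :
    IsSublinear a (relax p y) := by
  obtain ⟨k1, k2, k3, k4, -⟩ := relax_properties hpos hp.mono hp.map_zero hp.add_le hp.le_nsmul y hy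
  refine ⟨k1, k2, k3, k4, fun x => le_iInf fun n => ENNReal.le_sub_of_add_le_right
    (ENNReal.mul_ne_top (ENNReal.natCast_ne_top n) hy) ?_⟩
  calc CuSemigroup.relax p y x + 1 + n * p y = (CuSemigroup.relax p y x + n * p y) + 1 := by ring
    _ ≤ p (x + n • y) + 1 := by
      gcongr; exact relax_add_le hpos hp.mono hp.le_nsmul y x n
    _ ≤ p (x + n • y + a) := hp.add_one_le _
    _ = _ := by rw [add_right_comm]

/-- Hahn–Banach: below each sublinear map there is an additive one. -/
theorem IsSublinear.exists_additive (hpos : ∀ s : S, 0 ≤ s) {a : S} {p : S → ℝ≥0∞}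
    (hp : IsSublinear a p) :
    ∃ l : S →+o ℝ≥0∞, (∀ x, l x ≤ p x) ∧ 1 ≤ l a := by
  obtain ⟨m, hmp, hm⟩ := zorn_le_nonempty₀ (α := (S → ℝ≥0∞)ᵒᵈ)
    {q | IsSublinear a (OrderDual.ofDual q)} (by
      intro c hc hchain q₀ hq₀
      refine ⟨OrderDual.toDual fun x => ⨅ q : c, OrderDual.ofDual q.1 x, ?_, ?_⟩
      · have hne : Nonempty c := ⟨⟨q₀, hq₀⟩⟩
        refine ⟨fun x y hxy => iInf_mono fun q => (hc q.2).mono hxy, ?_, ?_, ?_, ?_⟩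
        · refine le_antisymm ((iInf_le _ ⟨q₀, hq₀⟩).trans (hc hq₀).map_zero.le) zero_le
        · intro x y
          simp only [OrderDual.ofDual_toDual]
          rw [ENNReal.iInf_add]
          refine le_iInf fun q => ?_
          rw [ENNReal.add_iInf]
          refine le_iInf fun r => ?_
          rcases hchain.total q.2 r.2 with h | h
          · exact (iInf_le _ r).trans (((hc r.2).add_le x y).trans (add_le_add_left (h x) _))
          · exact (iInf_le _ q).trans (((hc q.2).add_le x y).trans (add_le_add_right (h y) _))
        · intro n x
          refine le_iInf fun q => le_trans ?_ ((hc q.2).le_nsmul n x)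
          gcongr
          exact iInf_le _ q
        · intro x
          refine le_iInf fun q => le_trans ?_ ((hc q.2).add_one_le x)
          gcongr
          exact iInf_le _ q
      · intro q hq x
        exact iInf_le (fun q : c => OrderDual.ofDual q.1 x) ⟨q, hq⟩)
    (OrderDual.toDual p) hp
  have hs : IsSublinear a (OrderDual.ofDual m) := hm.1
  set q := OrderDual.ofDual m with hq
  have hadd : ∀ x y, q (x + y) = q x + q y := by
    intro x y
    refine le_antisymm (hs.add_le x y) ?_
    by_cases hy : q y = ⊤
    · have : q y ≤ q (x + y) := hs.mono (le_add_of_nonneg_left (hpos x))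
      rw [hy, top_le_iff] at this
      rw [this]; exact le_top
    have h1 : IsSublinear a (CuSemigroup.relax q y) := IsSublinear.relax hpos hs hy
    have h2 : q ≤ CuSemigroup.relax q y :=
      hm.2 (y := OrderDual.toDual (CuSemigroup.relax q y)) h1 (fun x => relax_le q y x)
    have h3 := (relax_properties hpos hs.mono hs.map_zero hs.add_le hs.le_nsmul y hy).2.2.2.2 x
    exact (add_le_add_left (h2 x) _).trans (h3.trans (relax_le q y _))
  refine ⟨⟨⟨⟨q, hs.map_zero⟩, hadd⟩, hs.mono⟩, fun x => hmp x, ?_⟩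
  have := hs.add_one_le 0
  rwa [hs.map_zero, zero_add, zero_add] at this

/-- If no multiple of `a` is below the same multiple of `b`, then a state separates them. -/
theorem exists_state (hpos : ∀ s : S, 0 ≤ s) {a b : S} (h : ∀ N : ℕ, 0 < N → ¬ N • a ≤ N • b) :
    ∃ l : S →+o ℝ≥0∞, l b ≤ 1 ∧ 1 ≤ l a := by
  set p : S → ℝ≥0∞ := fun x => ⨅ (m : ℕ) (n : ℕ) (_ : 0 < m ∧ m • x ≤ n • b), (n : ℝ≥0∞) / m
    with hp
  have ple : ∀ {x : S} {m n : ℕ}, 0 < m → m • x ≤ n • b → p x ≤ (n : ℝ≥0∞) / m :=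
    fun {x m n} hm hx => (iInf_le _ m).trans ((iInf_le _ n).trans (iInf_le _ ⟨hm, hx⟩))
  have lep : ∀ {x : S} {c : ℝ≥0∞}, (∀ m n : ℕ, 0 < m → m • x ≤ n • b → c ≤ (n : ℝ≥0∞) / m) →
      c ≤ p x := fun {x c} hc => le_iInf fun m => le_iInf fun n => le_iInf fun hx => hc m n hx.1 hx.2
  have hmono : Monotone p := fun x y hxy =>
    lep fun m n hm hy => ple hm ((nsmul_le_nsmul_right hxy m).trans hy)
  have h0 : p 0 = 0 := le_antisymm ((ple one_pos (n := 0) (by simp)).trans (by simp)) zero_le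
  have hadd : ∀ x y, p (x + y) ≤ p x + p y := by
    intro x y
    simp only [hp, ENNReal.iInf_add, ENNReal.add_iInf]
    refine le_iInf fun m => le_iInf fun n => le_iInf fun hy => le_iInf fun m' => le_iInf fun n' =>
      le_iInf fun hx => ?_
    have hm0 : (m : ℝ≥0∞) ≠ 0 := by exact_mod_cast hy.1.ne'
    have hm0' : (m' : ℝ≥0∞) ≠ 0 := by exact_mod_cast hx.1.ne'
    refine (ple (x := x + y) (m := m * m') (n := m * n' + m' * n)
      (Nat.mul_pos hy.1 hx.1) ?_).trans ?_
    · rw [nsmul_add, add_nsmul, mul_nsmul' x, mul_comm m m', mul_nsmul' y, mul_nsmul' b,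
        mul_nsmul' b]
      exact add_le_add (nsmul_le_nsmul_right hx.2 m) (nsmul_le_nsmul_right hy.2 m')
    · push_cast
      rw [ENNReal.add_div, ENNReal.mul_div_mul_left _ _ hm0 (ENNReal.natCast_ne_top _),
        mul_comm (m : ℝ≥0∞) m', ENNReal.mul_div_mul_left _ _ hm0' (ENNReal.natCast_ne_top _)]
  have hnsmul : ∀ (n : ℕ) x, n * p x ≤ p (n • x) := by
    intro k x
    rcases Nat.eq_zero_or_pos k with rfl | hk
    · simp
    refine lep fun m n hm hx => ?_
    have hk0 : (k : ℝ≥0∞) ≠ 0 := by exact_mod_cast hk.ne'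
    calc (k : ℝ≥0∞) * p x ≤ k * (n / (m * k : ℕ)) := by
          gcongr
          exact ple (Nat.mul_pos hm hk) (by rwa [mul_nsmul'])
      _ = n / m := by
          push_cast
          rw [← mul_div_assoc, mul_comm (m : ℝ≥0∞) k,
            ENNReal.mul_div_mul_left _ _ hk0 (ENNReal.natCast_ne_top _)]
  have hb : p b ≤ 1 := (ple one_pos (n := 1) le_rfl).trans (by simp)
  have ha : 1 ≤ p a := by
    refine lep fun m n hm hmn => ?_
    by_contra hlt
    rw [not_le, ENNReal.div_lt_iff (Or.inl (by exact_mod_cast hm.ne'))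
      (Or.inl (ENNReal.natCast_ne_top _)), one_mul] at hlt
    have hlt' : n < m := by exact_mod_cast hlt
    exact h m hm (hmn.trans (nsmul_le_nsmul_left (hpos b) hlt'.le))
  by_cases hat : p a = ⊤
  · obtain ⟨l, hl, hla⟩ := IsSublinear.exists_additive hpos (a := a) (p := p)
      ⟨hmono, h0, hadd, hnsmul, fun x => by
        have : p a ≤ p (x + a) := hmono (le_add_of_nonneg_left (hpos x))
        rw [hat, top_le_iff] at this
        rw [this]; exact le_top⟩
    exact ⟨l, (hl b).trans hb, hla⟩
  · obtain ⟨k1, k2, k3, k4, k5⟩ := relax_properties hpos hmono h0 hadd hnsmul a hat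
    obtain ⟨l, hl, hla⟩ := IsSublinear.exists_additive hpos (a := a) (p := relax p a)
      ⟨k1, k2, k3, k4, fun x => (add_le_add_right ha _).trans (k5 x)⟩
    exact ⟨l, (hl b).trans ((relax_le p a b).trans hb), hla⟩

/-- Comparison of functionals yields comparison of multiples in the semigroup. -/
theorem exists_nsmul_le (hpos : ∀ s : S, 0 ≤ s) (h2 : AxiomO2 S) (h3 : AxiomO3 S)
    (h4 : AxiomO4 S) {s' s t : S} (hs : WayBelow s' s) (hst : ∀ l, hat s l ≤ hat t l)
    {p q : ℕ} (hpq : p < q) : ∃ N, 0 < N ∧ (N * p) • s' ≤ (N * q) • t := by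
  by_contra! hcon
  obtain ⟨l, hl1, hl2⟩ := exists_state hpos (a := p • s') (b := q • t) (fun N hN => by
    rw [← mul_nsmul', ← mul_nsmul']; exact hcon N hN)
  rw [map_nsmul, nsmul_eq_mul] at hl1 hl2
  have h5 : l s' ≤ l t := (le_hat_regularize hpos h2 h3 h4 l hs).trans
    ((hst _).trans (hat_regularize_le hpos h2 h3 h4 l t))
  have hlt : l t ≠ ⊤ := by
    intro h
    rw [h, ENNReal.mul_top (by exact_mod_cast (by omega : q ≠ 0))] at hl1
    exact absurd hl1 (by simp)
  have h0 : l t ≠ 0 := by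
    intro h
    rw [h, nonpos_iff_eq_zero] at h5
    rw [h5] at hl2
    simp at hl2
  have h6 : (p : ℝ≥0∞) * l t < q * l t := by
    rw [ENNReal.mul_lt_mul_iff_left h0 hlt]
    exact_mod_cast hpq
  exact absurd (hl2.trans ((mul_le_mul_right h5 _))) (not_le.2 (h6.trans_le hl1))

end States

/-- Positively ordered semigroups satisfying the axioms O1 to O6. -/
structure SatisfiesAxioms (S : Type*) [AddCommMonoid S] [PartialOrder S] : Prop where
  pos : ∀ s : S, 0 ≤ s
  o1 : AxiomO1 S
  o2 : AxiomO2 S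
  o3 : AxiomO3 S
  o4 : AxiomO4 S
  o5 : AxiomO5 S
  o6 : AxiomO6 S

section Ratio

theorem natCast_div_le_div {a b c d : ℕ} (hb : 0 < b) (hd : 0 < d) (h : a * d ≤ c * b) :
    (a : ℝ≥0∞) / b ≤ c / d := by
  have hb0 : (b : ℝ≥0∞) ≠ 0 := by exact_mod_cast hb.ne'
  have hd0 : (d : ℝ≥0∞) ≠ 0 := by exact_mod_cast hd.ne'
  refine ENNReal.div_le_of_le_mul ?_
  rw [← ENNReal.mul_div_right_comm, ENNReal.le_div_iff_mul_le (Or.inl hd0)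
    (Or.inl (ENNReal.natCast_ne_top _))]
  exact_mod_cast h

/-- The ratio `k / (k + 1)`. -/
noncomputable def ratio (k : ℕ) : ℝ≥0∞ := (k : ℝ≥0∞) / (k + 1 : ℕ)

theorem ratio_mono : Monotone ratio := fun a b h =>
  natCast_div_le_div (Nat.succ_pos a) (Nat.succ_pos b) (by nlinarith)

theorem ratio_le_one (k : ℕ) : ratio k ≤ 1 := by
  have := natCast_div_le_div (a := k) (c := 1) (Nat.succ_pos k) one_pos (by omega)
  simpa [ratio] using this

theorem ratio_ne_top (k : ℕ) : ratio k ≠ ⊤ := ne_top_of_le_ne_top ENNReal.one_ne_top (ratio_le_one k)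

theorem succ_mul_ratio (k : ℕ) : ((k + 1 : ℕ) : ℝ≥0∞) * ratio k = k :=
  ENNReal.mul_div_cancel (by exact_mod_cast (Nat.succ_ne_zero k)) (ENNReal.natCast_ne_top _)

theorem ratio_le_ratio_mul_ratio (k : ℕ) :
    ratio k ≤ ratio (2 * k + 1) * ratio (2 * k + 1) := by
  have h := natCast_div_le_div (a := k) (b := k + 1) (c := (2 * k + 1) * (2 * k + 1))
    (d := (2 * k + 1 + 1) * (2 * k + 1 + 1)) (Nat.succ_pos k) (by positivity) (by nlinarith)
  refine h.trans (le_of_eq ?_)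
  rw [Nat.cast_mul, Nat.cast_mul, ratio, ENNReal.mul_div_mul_comm]
  · exact Or.inl (Nat.cast_ne_zero.2 (Nat.succ_ne_zero _))
  · exact Or.inl (ENNReal.natCast_ne_top _)

theorem iSup_ratio : ⨆ k, ratio k = 1 := by
  refine le_antisymm (iSup_le ratio_le_one) ?_
  have h : Tendsto ratio atTop (𝓝 1) := by
    have h1 := ENNReal.tendsto_ofReal (tendsto_natCast_div_add_atTop (𝕜 := ℝ) 1)
    rw [ENNReal.ofReal_one] at h1
    refine h1.congr fun k => ?_
    rw [ENNReal.ofReal_div_of_pos (by positivity), ratio]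
    congr 1
    · simp
    · rw [← Nat.cast_succ, ENNReal.ofReal_natCast]
  exact le_of_tendsto' h fun k => le_iSup ratio k

end Ratio

section Frac

variable {S : Type*} [AddCommMonoid S] [PartialOrder S]

/-- The function `ŝ / n`. -/
noncomputable def frac (s : S) (n : ℕ) : Functional S → ℝ≥0∞ := fun l => hat s l / (n : ℝ≥0∞)

theorem frac_mono {s t : S} (h : s ≤ t) (n : ℕ) : frac s n ≤ frac t n := fun l =>
  ENNReal.div_le_div_right (hat_mono h l) _

theorem frac_add (s t : S) (n : ℕ) : frac (s + t) n = frac s n + frac t n := by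
  ext l; simp [frac, hat_add, ENNReal.add_div]

theorem frac_nsmul_mul {m : ℕ} (hm : 0 < m) (s : S) (n : ℕ) : frac (m • s) (m * n) = frac s n := by
  ext l
  rw [frac, frac, hat_nsmul, Nat.cast_mul, ENNReal.mul_div_mul_left _ _
    (by exact_mod_cast hm.ne') (ENNReal.natCast_ne_top _)]

theorem ratio_mul_frac (k : ℕ) (s : S) (n : ℕ) (l : Functional S) :
    ratio k * frac s n l = frac (k • s) ((k + 1) * n) l := by
  rw [frac, frac, hat_nsmul, Nat.cast_mul, ENNReal.mul_div_mul_comm, ratio]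
  · exact Or.inl (Nat.cast_ne_zero.2 (Nat.succ_ne_zero _))
  · exact Or.inl (ENNReal.natCast_ne_top _)

theorem frac_div (s : S) (n m : ℕ) (hm : 0 < m) (l : Functional S) :
    frac s n l / m = frac s (n * m) l := by
  rw [frac, frac, Nat.cast_mul, div_eq_mul_inv, div_eq_mul_inv, div_eq_mul_inv,
    ENNReal.mul_inv (Or.inr (ENNReal.natCast_ne_top _))
      (Or.inr (by exact_mod_cast hm.ne')), mul_assoc]

theorem hat_le_of_frac_le {s t : S} {n m : ℕ} (hn : 0 < n) (hm : 0 < m) {l : Functional S}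
    (h : frac s n l ≤ frac t m l) : hat (m • s) l ≤ hat (n • t) l := by
  have hn0 : (n : ℝ≥0∞) ≠ 0 := by exact_mod_cast hn.ne'
  have hm0 : (m : ℝ≥0∞) ≠ 0 := by exact_mod_cast hm.ne'
  rw [frac, frac, ENNReal.div_le_iff hn0 (ENNReal.natCast_ne_top _),
    ← ENNReal.mul_div_right_comm, ENNReal.le_div_iff_mul_le (Or.inl hm0)
    (Or.inl (ENNReal.natCast_ne_top _))] at h
  rw [hat_nsmul, hat_nsmul, mul_comm, mul_comm (n : ℝ≥0∞)]
  exact h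

theorem isRealified_frac (s : S) {n : ℕ} (hn : 0 < n) : IsRealified (frac s n) :=
  ⟨fun _ => s, fun _ => n, fun _ => hn, monotone_const, fun l => by simp [frac]⟩

theorem IsRealified.div {f : Functional S → ℝ≥0∞} (hf : IsRealified f) {m : ℕ} (hm : 0 < m) :
    IsRealified fun l => f l / m := by
  obtain ⟨s, n, hn, hs, hfs⟩ := hf
  refine ⟨s, fun i => n i * m, fun i => Nat.mul_pos (hn i) hm, fun i j hij l => ?_, fun l => ?_⟩
  · have h := ENNReal.div_le_div_right (hs hij l) (m : ℝ≥0∞)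
    have h1 := frac_div (s i) (n i) m hm l
    have h2 := frac_div (s j) (n j) m hm l
    simp only [frac] at h1 h2
    simpa only [h1, h2] using h
  · have h1 := fun i => frac_div (s i) (n i) m hm l
    simp only [frac] at h1
    simp only [hfs, ENNReal.iSup_div, h1]

/-- `f` is far below `g` if `f ≤ r * ŝ' / n` and `ŝ / n ≤ g` for some `s' ≪ s` and `r < 1`. -/
def FarBelow (f g : Functional S → ℝ≥0∞) : Prop :=
  ∃ (s' s : S) (n k : ℕ), WayBelow s' s ∧ 0 < n ∧ (∀ l, f l ≤ ratio k * frac s' n l) ∧ frac s n ≤ g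

theorem FarBelow.mono {f₀ f g g₀ : Functional S → ℝ≥0∞} (h : FarBelow f g) (hf : f₀ ≤ f)
    (hg : g ≤ g₀) : FarBelow f₀ g₀ := by
  obtain ⟨s', s, n, k, h1, h2, h3, h4⟩ := h
  exact ⟨s', s, n, k, h1, h2, fun l => (hf l).trans (h3 l), h4.trans hg⟩

theorem FarBelow.le {f g : Functional S → ℝ≥0∞} (h : FarBelow f g) : f ≤ g := by
  obtain ⟨s', s, n, k, h1, h2, h3, h4⟩ := h
  intro l
  calc f l ≤ ratio k * frac s' n l := h3 l
    _ ≤ 1 * frac s n l := mul_le_mul' (ratio_le_one k) (frac_mono h1.le n l)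
    _ ≤ g l := by rw [one_mul]; exact h4 l

theorem farBelow_zero (hpos : ∀ s : S, 0 ≤ s) (g : Functional S → ℝ≥0∞) : FarBelow 0 g :=
  ⟨0, 0, 1, 0, wayBelow_zero hpos 0, one_pos, fun _ => zero_le,
    fun l => by simp [frac, hat_zero]⟩

theorem FarBelow.div {f g : Functional S → ℝ≥0∞} (h : FarBelow f g) {m : ℕ} (hm : 0 < m) :
    FarBelow (fun l => f l / m) fun l => g l / m := by
  obtain ⟨s', s, n, k, h1, h2, h3, h4⟩ := h
  refine ⟨s', s, n * m, k, h1, Nat.mul_pos h2 hm, fun l => ?_, fun l => ?_⟩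
  · rw [← frac_div _ _ _ hm, ← mul_div_assoc]
    exact ENNReal.div_le_div_right (h3 l) _
  · rw [← frac_div _ _ _ hm]
    exact ENNReal.div_le_div_right (h4 l) _

theorem FarBelow.add (hS : SatisfiesAxioms S) {f₁ g₁ f₂ g₂ : Functional S → ℝ≥0∞}
    (h₁ : FarBelow f₁ g₁) (h₂ : FarBelow f₂ g₂) : FarBelow (f₁ + f₂) (g₁ + g₂) := by
  obtain ⟨s', s, n, k, h1, h2, h3, h4⟩ := h₁
  obtain ⟨t', t, m, j, i1, i2, i3, i4⟩ := h₂
  have key : ∀ (a b : S), frac (m • a + n • b) (n * m) = frac a n + frac b m := by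
    intro a b
    rw [frac_add, frac_nsmul_mul h2, mul_comm n m, frac_nsmul_mul i2]
  refine ⟨m • s' + n • t', m • s + n • t, n * m, max k j,
    hS.o3 _ _ _ _ (h1.nsmul hS.pos hS.o3 m) (i1.nsmul hS.pos hS.o3 n), Nat.mul_pos h2 i2,
    fun l => ?_, ?_⟩
  · rw [key, Pi.add_apply, Pi.add_apply, mul_add]
    exact add_le_add ((h3 l).trans (mul_le_mul_left (ratio_mono (le_max_left _ _)) _))
      ((i3 l).trans (mul_le_mul_left (ratio_mono (le_max_right _ _)) _))
  · rw [key]; exact add_le_add h4 i4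

theorem FarBelow.exists_scaled {f g : Functional S → ℝ≥0∞} (h : FarBelow f g) :
    ∃ (k : ℕ) (f' : Functional S → ℝ≥0∞), IsRealified f' ∧ FarBelow f' g ∧
      ∀ l, f l ≤ ratio k * f' l := by
  obtain ⟨s', s, n, k, h1, h2, h3, h4⟩ := h
  refine ⟨2 * k + 1, frac ((2 * k + 1) • s') ((2 * k + 1 + 1) * n),
    isRealified_frac _ (by positivity), ⟨s', s, n, 2 * k + 1, h1, h2, fun l => ?_, h4⟩, fun l => ?_⟩
  · rw [ratio_mul_frac]
  · rw [← ratio_mul_frac, ← mul_assoc]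
    exact (h3 l).trans (mul_le_mul_left (ratio_le_ratio_mul_ratio k) _)

/-- The functions `r * ŝ / n` with `s ∈ D` and `r = k / (k + 1)`. -/
def basis (D : Set S) : Set (Functional S → ℝ≥0∞) :=
  {f | ∃ d ∈ D, ∃ k n : ℕ, 0 < n ∧ f = frac (k • d) ((k + 1) * n)}

theorem basis_countable {D : Set S} (hD : D.Countable) : (basis D).Countable := by
  refine ((hD.prod (Set.countable_univ (α := ℕ × ℕ))).image
    fun x : S × (ℕ × ℕ) => frac (x.2.1 • x.1) ((x.2.1 + 1) * x.2.2)).mono ?_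
  rintro _ ⟨d, hd, k, n, -, rfl⟩
  exact ⟨(d, (k, n)), ⟨hd, trivial⟩, rfl⟩

theorem exists_frac_of_mem_basis {D : Set S} {f : Functional S → ℝ≥0∞} (hf : f ∈ basis D) :
    ∃ s n, 0 < n ∧ f = frac s n := by
  obtain ⟨d, -, k, n, hn, rfl⟩ := hf
  exact ⟨_, _, Nat.mul_pos (Nat.succ_pos k) hn, rfl⟩

theorem isRealified_of_mem_basis {D : Set S} {f : Functional S → ℝ≥0∞} (hf : f ∈ basis D) :
    IsRealified f := by
  obtain ⟨s, n, hn, rfl⟩ := exists_frac_of_mem_basis hf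
  exact isRealified_frac s hn

theorem FarBelow.exists_between_basis (hS : SatisfiesAxioms S) {D : Set S} (hD : IsDense D)
    {f g : Functional S → ℝ≥0∞} (h : FarBelow f g) :
    ∃ b ∈ basis D, FarBelow f b ∧ FarBelow b g := by
  obtain ⟨s', s, n, k, h1, h2, h3, h4⟩ := h
  obtain ⟨u, huD, hu, hus⟩ := hD s
  obtain ⟨t, hst, hts⟩ := h1.exists_between hS.o2
  obtain ⟨i, hi⟩ := hts u s hu.monotone hus le_rfl
  set K := 2 * k + 1
  refine ⟨frac (K • u i) ((K + 1) * n), ⟨u i, huD i, K, n, h2, rfl⟩,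
    ⟨K • s', K • u i, (K + 1) * n, K, (hst.mono le_rfl hi).nsmul hS.pos hS.o3 K, by positivity,
      fun l => ?_, le_rfl⟩,
    ⟨u i, s, n, K, hu.wayBelow hus i, h2, fun l => (ratio_mul_frac _ _ _ _).ge, h4⟩⟩
  rw [← ratio_mul_frac, ← mul_assoc]
  exact (h3 l).trans (mul_le_mul_left (ratio_le_ratio_mul_ratio k) _)

theorem FarBelow.exists_between (hS : SatisfiesAxioms S)
    {f g : Functional S → ℝ≥0∞} (h : FarBelow f g) :
    ∃ b, IsRealified b ∧ FarBelow f b ∧ FarBelow b g := by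
  have hD : IsDense (Set.univ : Set S) := fun s => by
    obtain ⟨u, hu, hus⟩ := hS.o2 s
    exact ⟨u, fun _ => trivial, hu, hus⟩
  obtain ⟨b, hb, h1, h2⟩ := h.exists_between_basis hS hD
  exact ⟨b, isRealified_of_mem_basis hb, h1, h2⟩

theorem IsRealified.sum {ι : Type*} (s : Finset ι) {f : ι → Functional S → ℝ≥0∞}
    (hf : ∀ i, IsRealified (f i)) : IsRealified (∑ i ∈ s, f i) :=
  (Realification S).sum_mem fun i _ => hf i

theorem FarBelow.sum (hS : SatisfiesAxioms S) {ι : Type*} (s : Finset ι)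
    {f g : ι → Functional S → ℝ≥0∞} (h : ∀ i, FarBelow (f i) (g i)) :
    FarBelow (∑ i ∈ s, f i) (∑ i ∈ s, g i) := by
  classical
  induction s using Finset.induction_on with
  | empty => simpa using farBelow_zero hS.pos 0
  | insert a s ha ih => simpa [Finset.sum_insert ha] using (h a).add hS ih

/-- Between `f'` and `f` there is a chain for `FarBelow` that increases slowly relative to `f`. -/
theorem FarBelow.exists_chain (hS : SatisfiesAxioms S) {f' f : Functional S → ℝ≥0∞}
    (h : FarBelow f' f) {N : ℕ} (hN : 0 < N) :
    ∃ u : ℕ → Functional S → ℝ≥0∞, (∀ j, IsRealified (u j)) ∧ f' ≤ u 0 ∧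
      (∀ j, FarBelow (u j) (u (j + 1))) ∧ (∀ j, FarBelow (u j) f) ∧
      ∀ (j : ℕ) l, u j l ≤ u 0 l + j * (f l / N) := by
  obtain ⟨b₀, hb₀, hb₁, hb₂⟩ := h.exists_between hS
  choose next hn1 hn2 hn3 using fun b : {b : Functional S → ℝ≥0∞ // FarBelow b f} =>
    b.2.exists_between hS
  set c : ℕ → {b : Functional S → ℝ≥0∞ // FarBelow b f} := fun n =>
    Nat.rec ⟨b₀, hb₂⟩ (fun _ b => ⟨next b, hn3 b⟩) n with hc
  have hcr : ∀ n, IsRealified (c n).1 := fun n => by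
    cases n with
    | zero => exact hb₀
    | succ n => exact hn1 (c n)
  have hcc : ∀ n, FarBelow (c n).1 (c (n + 1)).1 := fun n => hn2 (c n)
  have hcm : Monotone fun n => (c n).1 := monotone_nat_of_le_succ fun n => (hcc n).le
  have hN0 : (N : ℝ≥0∞) ≠ 0 := by exact_mod_cast hN.ne'
  have hconst : ∀ a : ℝ≥0∞, (∑ _i ∈ Finset.range N, a) / (N : ℝ≥0∞) = a := fun a => by
    rw [Finset.sum_const, Finset.card_range, nsmul_eq_mul, mul_comm,
      ENNReal.mul_div_cancel_right hN0 (ENNReal.natCast_ne_top _)]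
  set u : ℕ → Functional S → ℝ≥0∞ := fun j l =>
    (∑ i ∈ Finset.range N, (c (i + j)).1) l / N with hu
  have huu : ∀ j, FarBelow (u j) (u (j + 1)) := fun j =>
    (FarBelow.sum hS (Finset.range N) fun i => hcc (i + j)).div hN
  have huf : ∀ j, u j ≤ f := fun j l => by
    rw [← hconst (f l)]
    simp only [hu, Finset.sum_apply]
    gcongr with i
    exact (c (i + j)).2.le l
  refine ⟨u, fun j => (IsRealified.sum _ fun i => hcr (i + j)).div hN, fun l => ?_, huu,
    fun j => (huu j).mono le_rfl (huf (j + 1)), fun j l => ?_⟩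
  · rw [← hconst (f' l)]
    simp only [hu, Finset.sum_apply]
    gcongr with i
    exact (hb₁.le l).trans (hcm (Nat.zero_le (i + 0)) l)
  · induction j with
    | zero => simp
    | succ j ih =>
      have hstep : u (j + 1) l ≤ u j l + f l / N := by
        simp only [hu, Finset.sum_apply]
        rw [← ENNReal.add_div]
        gcongr
        calc ∑ i ∈ Finset.range N, (c (i + (j + 1))).1 l
            ≤ ∑ i ∈ Finset.range N, (c (i + 1 + j)).1 l + (c (0 + j)).1 l := by
              refine le_add_of_le_of_nonneg (le_of_eq ?_) zero_le
              refine Finset.sum_congr rfl fun i _ => ?_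
              rw [add_right_comm, add_assoc]
          _ = ∑ i ∈ Finset.range N, (c (i + j)).1 l + (c (N + j)).1 l := by
              rw [← Finset.sum_range_succ' (fun i => (c (i + j)).1 l), Finset.sum_range_succ]
          _ ≤ _ := by gcongr; exact (c (N + j)).2.le l
      calc u (j + 1) l ≤ u j l + f l / N := hstep
        _ ≤ u 0 l + j * (f l / N) + f l / N := by gcongr
        _ = _ := by push_cast; ring

end Frac

section Compactness

variable {S : Type*} [AddCommMonoid S] [PartialOrder S] [IsOrderedAddMonoid S]

theorem FarBelow.exists_le (hS : SatisfiesAxioms S) {f g : Functional S → ℝ≥0∞}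
    (h : FarBelow f g) {u : ℕ → Functional S → ℝ≥0∞} (hu : ∀ n, IsRealified (u n))
    (hm : Monotone u) (hg : ∀ l, g l ≤ ⨆ n, u n l) : ∃ n, f ≤ u n := by
  obtain ⟨s', s, n, k, h1, h2, h3, h4⟩ := h
  by_contra! hcon
  have hn0 : (n : ℝ≥0∞) ≠ 0 := by exact_mod_cast h2.ne'
  have hscaled : ∀ i, ∃ l : Functional S, u i l ≤ 1 ∧ 1 ≤ ratio k * frac s' n l := by
    intro i
    obtain ⟨l, hl⟩ : ∃ l, ¬ f l ≤ u i l := by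
      by_contra! hall
      exact hcon i hall
    rw [not_le] at hl
    obtain ⟨c, hc1, hc2⟩ := _root_.exists_between (hl.trans_le (h3 l))
    have hc0 : c ≠ 0 := (zero_le.trans_lt hc1).ne'
    have hct : c ≠ ⊤ := hc2.ne_top
    refine ⟨l.scale c⁻¹, ?_, ?_⟩
    · rw [(hu i).scale]
      calc c⁻¹ * u i l ≤ c⁻¹ * c := by gcongr
        _ = 1 := ENNReal.inv_mul_cancel hc0 hct
    · rw [(isRealified_frac s' h2).scale, mul_left_comm]
      calc 1 = c⁻¹ * c := (ENNReal.inv_mul_cancel hc0 hct).symm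
        _ ≤ _ := by gcongr
  choose l hl1 hl2 using hscaled
  obtain ⟨m, hm'⟩ := exists_ultrafilter_limit (hyperfilter ℕ) l
  set ν := regularize hS.pos hS.o2 hS.o3 hS.o4 m with hν
  have hle : g ν ≤ 1 := by
    refine (hg ν).trans (iSup_le fun j => ?_)
    obtain ⟨t, q, hq, -, ht⟩ := hu j
    rw [ht]
    refine iSup_le fun i => ?_
    refine ENNReal.div_le_of_le_mul ?_
    rw [one_mul]
    refine (hat_regularize_le _ _ _ _ m (t i)).trans ?_
    refine le_of_tendsto (hm' (t i)) ?_
    have hev : ∀ᶠ a in (hyperfilter ℕ : Filter ℕ), j ≤ a :=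
      Nat.hyperfilter_le_atTop (eventually_ge_atTop j)
    filter_upwards [hev] with a ha
    have h5 : hat (t i) (l a) / q i ≤ 1 := by
      refine le_trans ?_ ((hm ha (l a)).trans (hl1 a))
      rw [ht]
      exact le_iSup (fun i => hat (t i) (l a) / (q i : ℝ≥0∞)) i
    rwa [ENNReal.div_le_iff (by exact_mod_cast (hq i).ne') (ENNReal.natCast_ne_top _),
      one_mul] at h5
  have hge : 1 ≤ ratio k * (hat s ν / n) := by
    have h5 : 1 ≤ ratio k * (m s' / n) := by
      refine ge_of_tendsto' (ENNReal.Tendsto.const_mul (ENNReal.Tendsto.div_const (hm' s')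
        (Or.inr hn0)) (Or.inr (ratio_ne_top k))) fun a => hl2 a
    exact h5.trans (by gcongr; exact le_hat_regularize hS.pos hS.o2 hS.o3 hS.o4 m h1)
  have h6 : hat s ν / n ≤ 1 := (h4 ν).trans hle
  have h7 : (1 : ℝ≥0∞) ≤ ratio k := hge.trans (by
    calc ratio k * (hat s ν / n) ≤ ratio k * 1 := by gcongr
      _ = _ := mul_one _)
  have h8 : ((k + 1 : ℕ) : ℝ≥0∞) ≤ k := by
    calc ((k + 1 : ℕ) : ℝ≥0∞) = (k + 1 : ℕ) * 1 := (mul_one _).symm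
      _ ≤ (k + 1 : ℕ) * ratio k := by gcongr
      _ = k := succ_mul_ratio k
  have h9 : k + 1 ≤ k := by exact_mod_cast h8
  omega

theorem isRealified_iSup_of_directed {S : Type*} [AddCommMonoid S] [PartialOrder S]
    {ι : Type*} [Countable ι] [Nonempty ι]
    {W : ι → Functional S → ℝ≥0∞} (hW : ∀ i, ∃ s n, 0 < n ∧ W i = frac s n)
    (hd : Directed (· ≤ ·) W) :
    IsRealified (fun l => ⨆ i, W i l) ∧
      ∃ φ : ℕ → ι, Monotone (W ∘ φ) ∧ ∀ l, ⨆ i, W i l = ⨆ n, W (φ n) l := by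
  have := Encodable.ofCountable ι
  have := Classical.inhabited_of_nonempty ‹Nonempty ι›
  have hm : Monotone (W ∘ hd.sequence W) := hd.sequence_mono
  have heq : ∀ l, ⨆ i, W i l = ⨆ n, W (hd.sequence W n) l := fun l =>
    le_antisymm (iSup_le fun i => (hd.le_sequence i l).trans
      (le_iSup (fun n => W (hd.sequence W n) l) _))
      (iSup_le fun n => le_iSup (fun i => W i l) _)
  refine ⟨?_, _, hm, heq⟩
  choose s n hn hW using hW
  refine ⟨fun i => s (hd.sequence W i), fun i => n (hd.sequence W i), fun i => hn _, ?_, ?_⟩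
  · intro i j hij l
    have h := hm hij l
    simp only [Function.comp_apply, hW] at h
    exact h
  · intro l
    simp only [heq]
    simp only [hW]
    rfl

theorem IsRealified.exists_frac_seq (hS : SatisfiesAxioms S) {f : Functional S → ℝ≥0∞}
    (hf : IsRealified f) : ∃ u : ℕ → Functional S → ℝ≥0∞, (∀ i, ∃ s n, 0 < n ∧ u i = frac s n) ∧
      Monotone u ∧ (∀ i, FarBelow (u i) f) ∧ ∀ l, f l = ⨆ i, u i l := by
  obtain ⟨s, n, hn, hs, hfs⟩ := hf
  choose v hv hvs using fun i => hS.o2 (s i)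
  set W : ℕ × ℕ → Functional S → ℝ≥0∞ := fun x =>
    frac (x.2 • v x.1 x.2) ((x.2 + 1) * n x.1) with hWdef
  have hWr : ∀ i k l, W (i, k) l = ratio k * frac (v i k) (n i) l := fun i k l =>
    (ratio_mul_frac _ _ _ _).symm
  have hfi : ∀ i, frac (s i) (n i) ≤ f := fun i l => by
    rw [hfs]; exact le_iSup (fun i => hat (s i) l / (n i : ℝ≥0∞)) i
  have hWf : ∀ i k, FarBelow (W (i, k)) (frac (s i) (n i)) := fun i k =>
    ⟨v i k, s i, n i, k, (hv i).wayBelow (hvs i) k, hn i, fun l => (hWr i k l).le, le_rfl⟩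
  have hWm : ∀ i, Monotone fun k => W (i, k) := fun i k k' h l => by
    simp only [hWr]
    exact mul_le_mul' (ratio_mono h) (frac_mono ((hv i).monotone h) _ l)
  have hWs : ∀ i l, frac (s i) (n i) l = ⨆ k, W (i, k) l := by
    intro i l
    have h1 : IsLUB (Set.range fun k => hat (v i k) l) (hat (s i) l) :=
      l.map_isLUB' (v i) (s i) (hv i).monotone (hvs i)
    simp only [hWr]
    have h2 : frac (s i) (n i) l = ⨆ k, frac (v i k) (n i) l := by
      simp only [frac]
      rw [← ENNReal.iSup_div, h1.iSup_eq]
    refine le_antisymm ?_ (iSup_le fun k => ?_)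
    · rw [← one_mul (frac (s i) (n i) l), ← iSup_ratio, h2, ENNReal.iSup_mul]
      refine iSup_le fun a => ?_
      rw [ENNReal.mul_iSup]
      exact iSup_le fun b => le_iSup_of_le (max a b)
        (mul_le_mul' (ratio_mono (le_max_left _ _))
          (frac_mono ((hv i).monotone (le_max_right _ _)) _ l))
    · rw [← one_mul (frac (s i) (n i) l)]
      exact mul_le_mul' (ratio_le_one k) (frac_mono ((hv i).wayBelow (hvs i) k).le _ l)
  have hWrl : ∀ x, ∃ t m, 0 < m ∧ W x = frac t m := fun x =>
    ⟨_, _, Nat.mul_pos (Nat.succ_pos _) (hn x.1), rfl⟩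
  have hWR : ∀ x, IsRealified (W x) := fun x => by
    obtain ⟨t, m, hm, h⟩ := hWrl x
    exact h ▸ isRealified_frac t hm
  have hd : Directed (· ≤ ·) W := by
    rintro ⟨i, k⟩ ⟨i', k'⟩
    obtain ⟨a, ha⟩ := (hWf i k).exists_le hS (fun k => hWR (max i i', k)) (hWm (max i i'))
      (fun l => (hs (le_max_left i i') l).trans (hWs (max i i') l).le)
    obtain ⟨b, hb⟩ := (hWf i' k').exists_le hS (fun k => hWR (max i i', k)) (hWm (max i i'))
      (fun l => (hs (le_max_right i i') l).trans (hWs (max i i') l).le)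
    exact ⟨(max i i', max a b), ha.trans (hWm _ (le_max_left _ _)),
      hb.trans (hWm _ (le_max_right _ _))⟩
  obtain ⟨-, φ, hφ, hφs⟩ := isRealified_iSup_of_directed hWrl hd
  refine ⟨W ∘ φ, fun i => hWrl _, hφ, fun i => (hWf _ _).mono le_rfl (hfi _), fun l => ?_⟩
  simp only [Function.comp_apply, ← hφs, hfs, iSup_prod, ← hWs]
  rfl

theorem IsRealified.exists_seq (hS : SatisfiesAxioms S) {f : Functional S → ℝ≥0∞}
    (hf : IsRealified f) : ∃ u : ℕ → Functional S → ℝ≥0∞, (∀ i, IsRealified (u i)) ∧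
      Monotone u ∧ (∀ i, FarBelow (u i) f) ∧ ∀ l, f l = ⨆ i, u i l := by
  obtain ⟨u, hu, h⟩ := hf.exists_frac_seq hS
  refine ⟨u, fun i => ?_, h⟩
  obtain ⟨s, n, hn, h⟩ := hu i
  exact h ▸ isRealified_frac s hn

theorem isRealified_iSup (hS : SatisfiesAxioms S) {g : ℕ → Functional S → ℝ≥0∞}
    (hg : ∀ n, IsRealified (g n)) (hm : Monotone g) : IsRealified fun l => ⨆ n, g n l := by
  choose u hu hum huf hus using fun n => (hg n).exists_frac_seq hS
  have hur : ∀ n i, IsRealified (u n i) := fun n i => by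
    obtain ⟨t, m, hm, h⟩ := hu n i
    exact h ▸ isRealified_frac t hm
  have hd : Directed (· ≤ ·) fun x : ℕ × ℕ => u x.1 x.2 := by
    rintro ⟨i, k⟩ ⟨i', k'⟩
    obtain ⟨a, ha⟩ := (huf i k).exists_le hS (hur (max i i')) (hum _)
      (fun l => (hm (le_max_left i i') l).trans (hus (max i i') l).le)
    obtain ⟨b, hb⟩ := (huf i' k').exists_le hS (hur (max i i')) (hum _)
      (fun l => (hm (le_max_right i i') l).trans (hus (max i i') l).le)
    exact ⟨(max i i', max a b), ha.trans (hum _ (le_max_left _ _)),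
      hb.trans (hum _ (le_max_right _ _))⟩
  have h := (isRealified_iSup_of_directed (fun x : ℕ × ℕ => hu x.1 x.2) hd).1
  simpa only [iSup_prod, ← hus] using h

end Compactness

section Riesz

variable {S : Type*} [AddCommMonoid S] [PartialOrder S] [IsOrderedAddMonoid S]

/-- Inequalities in the realification can be lifted to the semigroup after taking multiples. -/
theorem FarBelow.exists_lift (hS : SatisfiesAxioms S) {f' f : Functional S → ℝ≥0∞}
    (h : FarBelow f' f) {y : ℕ → S} {m : ℕ → ℕ} (hm : ∀ j, 0 < m j)
    (hmono : Monotone fun j => frac (y j) (m j)) (hf : ∀ l, f l ≤ ⨆ j, frac (y j) (m j) l)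
    (j₀ : ℕ) : ∃ j N, j₀ ≤ j ∧ 0 < N ∧ ∃ x' x, WayBelow x' x ∧ x ≤ N • y j ∧
      f' ≤ frac x' (N * m j) ∧ frac x (N * m j) ≤ f := by
  obtain ⟨s', s, n, k, h1, h2, h3, h4⟩ := h
  obtain ⟨s₁, hs₁, hs₁'⟩ := h1.exists_between hS.o2
  obtain ⟨s₂, hs₂, hs₂'⟩ := hs₁'.exists_between hS.o2
  set K := 2 * k + 1
  obtain ⟨j, hj⟩ := FarBelow.exists_le hS (f := frac (K • s₂) ((K + 1) * n)) (g := f)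
    ⟨s₂, s, n, K, hs₂', h2, fun l => (ratio_mul_frac _ _ _ _).ge, h4⟩
    (fun j => isRealified_frac (y j) (hm j)) hmono hf
  obtain ⟨i, hi0, hi⟩ : ∃ i, j₀ ≤ i ∧ frac (K • s₂) ((K + 1) * n) ≤ frac (y i) (m i) :=
    ⟨max j j₀, le_max_right _ _, hj.trans (hmono (le_max_left _ _))⟩
  obtain ⟨N, hN, hle⟩ := exists_nsmul_le hS.pos hS.o2 hS.o3 hS.o4
    (((hs₂.nsmul hS.pos hS.o3 K)).nsmul hS.pos hS.o3 (m i))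
    (fun l => hat_le_of_frac_le (by positivity) (hm i) (hi l)) (Nat.lt_succ_self K)
  have key : ∀ (t : S), frac ((N * K) • m i • K • t) (N * (K + 1) * ((K + 1) * n) * m i) =
      fun l => ratio K * (ratio K * frac t n l) := by
    intro t
    ext l
    rw [ratio_mul_frac, ratio_mul_frac, ← frac_nsmul_mul (Nat.mul_pos hN (hm i)) (K • K • t)]
    congr 1
    · simp only [smul_smul]; congr 1; ring
    · ring
  refine ⟨i, N * (K + 1) * ((K + 1) * n), hi0, by positivity, (N * K) • m i • K • s',
    (N * K) • m i • K • s₁,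
    ((hs₁.nsmul hS.pos hS.o3 K).nsmul hS.pos hS.o3 (m i)).nsmul hS.pos hS.o3 _, ?_, ?_, ?_⟩
  · rw [← smul_smul (N * (K + 1))]; exact hle
  · rw [key]
    intro l
    dsimp only
    rw [← mul_assoc]
    exact (h3 l).trans (mul_le_mul_left (ratio_le_ratio_mul_ratio k) _)
  · rw [key]
    intro l
    calc ratio K * (ratio K * frac s₁ n l) ≤ 1 * (1 * frac s n l) :=
          mul_le_mul' (ratio_le_one K) (mul_le_mul' (ratio_le_one K)
            (frac_mono (hs₂.mono le_rfl hs₂'.le).le n l))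
      _ = frac s n l := by simp
      _ ≤ f l := h4 l

/-- The almost algebraic order of the realification. -/
theorem exists_complement (hS : SatisfiesAxioms S) {f' f g' g : Functional S → ℝ≥0∞}
    (hf : FarBelow f' f) (hfg : f ≤ g) (hg' : FarBelow g' g) (hg : IsRealified g) :
    ∃ r, IsRealified r ∧ f' + r ≤ g ∧ g' ≤ f + r := by
  obtain ⟨y, m, hm, hmono, hy⟩ := hg
  obtain ⟨j₀, hj₀⟩ := hg'.exists_le hS (fun j => isRealified_frac (y j) (hm j)) hmono
    (fun l => (hy l).le)
  obtain ⟨j, N, hj, hN, x', x, hx, hxy, h1, h2⟩ := hf.exists_lift hS hm hmono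
    (fun l => (hfg l).trans (hy l).le) j₀
  obtain ⟨r, hr1, hr2⟩ := hS.o5 _ _ _ hx hxy
  refine ⟨frac r (N * m j), isRealified_frac r (Nat.mul_pos hN (hm j)), ?_, ?_⟩
  · calc f' + frac r (N * m j) ≤ frac x' (N * m j) + frac r (N * m j) := add_le_add_left h1 _
      _ = frac (x' + r) (N * m j) := (frac_add _ _ _).symm
      _ ≤ frac (N • y j) (N * m j) := frac_mono hr1 _
      _ = frac (y j) (m j) := frac_nsmul_mul hN _ _
      _ ≤ g := fun l => by
        rw [hy]; exact le_iSup (fun i => hat (y i) l / (m i : ℝ≥0∞)) j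
  · calc g' ≤ frac (y j₀) (m j₀) := hj₀
      _ ≤ frac (y j) (m j) := hmono hj
      _ = frac (N • y j) (N * m j) := (frac_nsmul_mul hN _ _).symm
      _ ≤ frac (x + r) (N * m j) := frac_mono hr2 _
      _ = frac x (N * m j) + frac r (N * m j) := frac_add _ _ _
      _ ≤ f + frac r (N * m j) := add_le_add_left h2 _

/-- The weak Riesz decomposition property of the realification. -/
theorem exists_decomposition (hS : SatisfiesAxioms S) {f' f g h : Functional S → ℝ≥0∞}
    (hf : FarBelow f' f) (hfgh : f ≤ g + h) (hg : IsRealified g) (hh : IsRealified h) :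
    ∃ g' h', IsRealified g' ∧ IsRealified h' ∧ f' ≤ g' + h' ∧ g' ≤ g ∧ g' ≤ f ∧ h' ≤ h ∧ h' ≤ f := by
  obtain ⟨a, m, hm, hma, ha⟩ := hg
  obtain ⟨b, n, hn, hmb, hb⟩ := hh
  have key : ∀ i, frac (n i • a i + m i • b i) (m i * n i) = frac (a i) (m i) + frac (b i) (n i) := by
    intro i
    rw [frac_add, frac_nsmul_mul (hm i), mul_comm (m i), frac_nsmul_mul (hn i)]
  obtain ⟨j, N, -, hN, x', x, hx, hxy, h1, h2⟩ := hf.exists_lift hS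
    (y := fun i => n i • a i + m i • b i) (m := fun i => m i * n i)
    (fun i => Nat.mul_pos (hm i) (hn i))
    (by
      intro i j hij
      simp only [key]
      exact add_le_add (hma hij) (hmb hij))
    (by
      intro l
      simp only [key]
      refine (hfgh l).trans (le_of_eq ?_)
      rw [Pi.add_apply, ha, hb, ENNReal.iSup_add_iSup_of_monotone (fun i j hij => hma hij l)
        (fun i j hij => hmb hij l)]
      rfl) 0
  rw [nsmul_add] at hxy
  obtain ⟨r, t, hrt, ⟨hr1, hr2⟩, ht1, ht2⟩ := hS.o6 _ _ _ hxy _ hx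
  have hpos : 0 < N * (m j * n j) := Nat.mul_pos hN (Nat.mul_pos (hm j) (hn j))
  refine ⟨frac r (N * (m j * n j)), frac t (N * (m j * n j)), isRealified_frac r hpos,
    isRealified_frac t hpos, ?_, ?_, (frac_mono hr2 _).trans h2, ?_, (frac_mono ht2 _).trans h2⟩
  · rw [← frac_add]; exact h1.trans (frac_mono hrt _)
  · refine (frac_mono hr1 _).trans ?_
    rw [frac_nsmul_mul hN, mul_comm, frac_nsmul_mul (hn j)]
    intro l
    rw [ha]; exact le_iSup (fun i => hat (a i) l / (m i : ℝ≥0∞)) j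
  · refine (frac_mono ht1 _).trans ?_
    rw [frac_nsmul_mul hN, frac_nsmul_mul (hm j)]
    intro l
    rw [hb]; exact le_iSup (fun i => hat (b i) l / (n i : ℝ≥0∞)) j

end Riesz

section Lattice

theorem le_of_add_le_add_of_top {a x y : ℝ≥0∞} (h : a + x ≤ a + y) (ha : a = ⊤ → y = ⊤) :
    x ≤ y := by
  by_cases hat : a = ⊤
  · rw [ha hat]; exact le_top
  · exact (ENNReal.add_le_add_iff_left hat).1 h

theorem ratio_mul_le {K : ℕ} {x e X : ℝ≥0∞} (hX : X ≤ x + e) (he : K * e ≤ x) :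
    ratio K * X ≤ x := by
  calc ratio K * X = K * X / (K + 1 : ℕ) := by rw [ratio, ENNReal.mul_div_right_comm]
    _ ≤ ((K + 1 : ℕ) * x) / (K + 1 : ℕ) := by
      refine ENNReal.div_le_div_right ?_ _
      calc K * X ≤ K * (x + e) := by gcongr
        _ = K * x + K * e := mul_add _ _ _
        _ ≤ K * x + x := by gcongr
        _ = (K + 1 : ℕ) * x := by push_cast; ring
    _ = x := by
      rw [mul_comm, ENNReal.mul_div_cancel_right (Nat.cast_ne_zero.2 (Nat.succ_ne_zero _))
        (ENNReal.natCast_ne_top _)]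

theorem natCast_mul_div_mul {c K : ℕ} (hc : 0 < c) (hK : 0 < K) (x : ℝ≥0∞) :
    (c : ℝ≥0∞) * (K * (x / (c * K : ℕ))) = x := by
  rw [← mul_assoc, ← Nat.cast_mul]
  exact ENNReal.mul_div_cancel (Nat.cast_ne_zero.2 (Nat.mul_pos hc hK).ne')
    (ENNReal.natCast_ne_top _)

theorem natCast_mul_div_mul_le {c K : ℕ} (hc : 0 < c) (hK : 0 < K) {x y : ℝ≥0∞} {d : ℕ}
    (h : d * x ≤ c * y) : K * (d * (x / (c * K : ℕ))) ≤ y := by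
  have hc0 : (c : ℝ≥0∞) ≠ 0 := Nat.cast_ne_zero.2 hc.ne'
  refine (ENNReal.mul_le_mul_iff_right hc0 (ENNReal.natCast_ne_top c)).1 ?_
  calc (c : ℝ≥0∞) * (K * (d * (x / (c * K : ℕ)))) = d * (c * (K * (x / (c * K : ℕ)))) := by ring
    _ = d * x := by rw [natCast_mul_div_mul hc hK]
    _ ≤ c * y := h

variable {S : Type*} [AddCommMonoid S] [PartialOrder S]

theorem IsRealified.ratio_mul {f : Functional S → ℝ≥0∞} (hf : IsRealified f) (k : ℕ) :
    IsRealified fun l => ratio k * f l := by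
  have h : IsRealified (k • f) := (Realification S).nsmul_mem (show f ∈ Realification S from hf) k
  convert h.div (Nat.succ_pos k) using 2 with l
  rw [Pi.smul_apply, nsmul_eq_mul, ratio, ENNReal.mul_div_right_comm]

theorem FarBelow.exists_scaled_of_le {f' f : Functional S → ℝ≥0∞} (h : FarBelow f' f) :
    ∃ (k : ℕ) (f'' : Functional S → ℝ≥0∞), FarBelow f'' f ∧
      ∀ K, k ≤ K → ∀ l, f' l ≤ ratio K * f'' l := by
  obtain ⟨k, f'', -, h2, h3⟩ := h.exists_scaled
  exact ⟨k, f'', h2, fun K hK l => (h3 l).trans (mul_le_mul_left (ratio_mono hK) _)⟩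

variable [IsOrderedAddMonoid S]

theorem FarBelow.exists_approx_left (hS : SatisfiesAxioms S)
    {v w f g : Functional S → ℝ≥0∞} (h : FarBelow v w) (hw : w ≤ f + g) (hf : IsRealified f)
    (hg : IsRealified g) : ∃ f', FarBelow f' f ∧ v ≤ f' + g := by
  obtain ⟨u, hu, hum, huf, hus⟩ := hf.exists_seq hS
  obtain ⟨n, hn⟩ := h.exists_le hS (u := fun n => u n + g) (fun n => (hu n).add hg)
    (fun i j hij => add_le_add_left (hum hij) g) (fun l => by
      refine (hw l).trans ?_
      rw [Pi.add_apply, hus, ENNReal.iSup_add]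
      rfl)
  exact ⟨u n, huf n, hn⟩

/-- Approximate interpolation in the realification. -/
theorem exists_approx_interpolation (hS : SatisfiesAxioms S)
    {h₁' h₁ h₂' h₂ f g : Functional S → ℝ≥0∞} (hh₁ : FarBelow h₁' h₁) (hh₂ : FarBelow h₂' h₂)
    (hf : IsRealified f) (hg : IsRealified g) (hr₁ : IsRealified h₁) (hr₂ : IsRealified h₂)
    (h₁f : h₁ ≤ f) (h₁g : h₁ ≤ g) (h₂f : h₂ ≤ f) (h₂g : h₂ ≤ g) {N : ℕ} (hN : 0 < N) :
    ∃ h, IsRealified h ∧ h₁' ≤ h ∧ h₂' ≤ h ∧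
      (∀ l, h l ≤ f l + (4 : ℕ) * ((h₁ l + h₂ l) / N)) ∧
      ∀ l, h l ≤ g l + (4 : ℕ) * ((h₁ l + h₂ l) / N) := by
  obtain ⟨u, hur, hu0, huu, huh, hus⟩ := hh₁.exists_chain hS hN
  obtain ⟨v, hvr, hv0, hvv, hvh, hvs⟩ := hh₂.exists_chain hS hN
  obtain ⟨p, hpr, hp1, hp2⟩ := exists_complement hS (huu 0) ((huh 1).le.trans h₁f)
    ((hvh 2).mono le_rfl h₂f) hf
  obtain ⟨q, hqr, hq1, hq2⟩ := exists_complement hS (huu 0) ((huh 1).le.trans h₁g)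
    ((hvh 2).mono le_rfl h₂g) hg
  obtain ⟨α, b, hαr, hbr, hαb, hα1, hα2, hb1, -⟩ :=
    exists_decomposition hS (hvv 1) hp2 (hur 1) hpr
  obtain ⟨α', hα', hv0b⟩ := (hvv 0).exists_approx_left hS hαb hαr hbr
  obtain ⟨a, har, ha0, haa, haα, has⟩ := hα'.exists_chain hS hN
  obtain ⟨b₁, hb₁r, hb₁1, hb₁2⟩ := exists_complement hS (haa 0) ((haα 1).le.trans hα2)
    (hvv 1) (hvr 2)
  obtain ⟨c, hcr, hc1, hc2⟩ := exists_complement hS (haa 0) ((haα 1).le.trans hα1)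
    (huu 0) (hur 1)
  set E : Functional S → ℝ≥0∞ := fun l => (h₁ l + h₂ l) / N with hE
  have hEr : IsRealified E := (hr₁.add hr₂).div hN
  have hE1 : ∀ l, h₁ l / N ≤ E l := fun l => ENNReal.div_le_div_right le_self_add _
  have hE2 : ∀ l, h₂ l / N ≤ E l := fun l => ENNReal.div_le_div_right le_add_self _
  have hαh : α ≤ h₁ := hα1.trans (huh 1).le
  have hE3 : ∀ l, α l / N ≤ E l := fun l => (ENNReal.div_le_div_right (hαh l) _).trans (hE1 l)
  have hu1 : ∀ l, u 1 l ≤ u 0 l + E l := fun l => (hus 1 l).trans (by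
    simpa using add_le_add_right (hE1 l) _)
  have hv2 : ∀ l, v 2 l ≤ v 0 l + (E l + E l) := fun l => (hvs 2 l).trans (by
    rw [← two_mul]; simpa using add_le_add_right (mul_le_mul_right (hE2 l) 2) _)
  have ha1 : ∀ l, a 1 l ≤ a 0 l + E l := fun l => (has 1 l).trans (by
    simpa using add_le_add_right (hE3 l) _)
  have htop : ∀ l, a 0 l = ⊤ → E l = ⊤ := fun l h => by
    have h1 : h₁ l = ⊤ := top_le_iff.1 (h ▸ (haα 0).le.trans hαh l)
    refine top_le_iff.1 ((hE1 l).trans' ?_)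
    rw [h1, ENNReal.top_div_of_ne_top (ENNReal.natCast_ne_top N)]
  have hb₁b : ∀ l, b₁ l ≤ b l + (E l + E l) := fun l => by
    refine le_of_add_le_add_of_top (a := a 0 l) ?_ (fun h => by simp [htop l h])
    calc a 0 l + b₁ l ≤ v 2 l := hb₁1 l
      _ ≤ v 0 l + (E l + E l) := hv2 l
      _ ≤ α' l + b l + (E l + E l) := add_le_add_left (hv0b l) _
      _ ≤ a 0 l + b l + (E l + E l) := by gcongr; exact ha0 l
      _ = _ := add_assoc _ _ _
  have hb₁c : b₁ ≤ c + (q + (E + E)) := fun l => by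
    refine le_of_add_le_add_of_top (a := a 0 l) ?_ (fun h => by simp [htop l h])
    calc a 0 l + b₁ l ≤ v 2 l := hb₁1 l
      _ ≤ u 1 l + q l := hq2 l
      _ ≤ u 0 l + E l + q l := by gcongr; exact hu1 l
      _ ≤ a 1 l + c l + E l + q l := by gcongr; exact hc2 l
      _ ≤ a 0 l + E l + c l + E l + q l := by gcongr; exact ha1 l
      _ = _ := by simp only [Pi.add_apply]; ring
  obtain ⟨b₀, hb₀, hvb₀⟩ := (hvv 0).exists_approx_left hS (by rwa [add_comm] at hb₁2) hb₁r (har 1)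
  obtain ⟨x, y, hxr, hyr, hxy, hxc, -, hyq, hyb⟩ := exists_decomposition hS hb₀ hb₁c hcr
    (hqr.add (hEr.add hEr))
  refine ⟨u 0 + (y + (E + E)), (hur 0).add (hyr.add (hEr.add hEr)), ?_, ?_, ?_, ?_⟩
  · exact fun l => (hu0 l).trans le_self_add
  · intro l
    calc h₂' l ≤ v 0 l := hv0 l
      _ ≤ b₀ l + a 1 l := hvb₀ l
      _ ≤ (x l + y l) + a 1 l := by gcongr; exact hxy l
      _ ≤ (c l + y l) + (a 0 l + E l) := by gcongr; exacts [hxc l, ha1 l]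
      _ = (a 0 l + c l) + (y l + E l) := by ring
      _ ≤ u 1 l + (y l + E l) := add_le_add_left (hc1 l) _
      _ ≤ (u 0 l + E l) + (y l + E l) := by gcongr; exact hu1 l
      _ = _ := by simp only [Pi.add_apply]; ring
  · intro l
    calc u 0 l + (y l + (E l + E l)) ≤ u 0 l + (b₁ l + (E l + E l)) := by gcongr; exact hyb l
      _ ≤ u 0 l + ((b l + (E l + E l)) + (E l + E l)) := by gcongr; exact hb₁b l
      _ ≤ u 0 l + ((p l + (E l + E l)) + (E l + E l)) := by gcongr; exact hb1 l
      _ = (u 0 l + p l) + (4 : ℕ) * E l := by push_cast; ring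
      _ ≤ f l + (4 : ℕ) * E l := add_le_add_left (hp1 l) _
  · intro l
    calc u 0 l + (y l + (E l + E l)) ≤ u 0 l + ((q l + (E l + E l)) + (E l + E l)) := by
          gcongr; exact hyq l
      _ = (u 0 l + q l) + (4 : ℕ) * E l := by push_cast; ring
      _ ≤ g l + (4 : ℕ) * E l := add_le_add_left (hq1 l) _

/-- Lower bounds of two elements of the realification are approximately directed. -/
theorem exists_interpolation (hS : SatisfiesAxioms S)
    {h₁' h₁ h₂' h₂ f g : Functional S → ℝ≥0∞} (hh₁ : FarBelow h₁' h₁) (hh₂ : FarBelow h₂' h₂)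
    (hf : IsRealified f) (hg : IsRealified g) (hr₁ : IsRealified h₁) (hr₂ : IsRealified h₂)
    (h₁f : h₁ ≤ f) (h₁g : h₁ ≤ g) (h₂f : h₂ ≤ f) (h₂g : h₂ ≤ g) :
    ∃ h, IsRealified h ∧ h₁' ≤ h ∧ h₂' ≤ h ∧ h ≤ f ∧ h ≤ g := by
  obtain ⟨k₁, c₁, hc₁, hk₁⟩ := hh₁.exists_scaled_of_le
  obtain ⟨k₂, c₂, hc₂, hk₂⟩ := hh₂.exists_scaled_of_le
  set K := max k₁ k₂ + 1
  have hK₁ : k₁ ≤ K := by omega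
  have hK₂ : k₂ ≤ K := by omega
  have hK : 0 < K := by omega
  obtain ⟨h, hr, hc₁h, hc₂h, h3, h4⟩ := exists_approx_interpolation hS hc₁ hc₂ hf hg hr₁ hr₂
    h₁f h₁g h₂f h₂g (N := 8 * K) (by positivity)
  have hle : ∀ {f : Functional S → ℝ≥0∞}, h₁ ≤ f → h₂ ≤ f → ∀ l,
      K * ((4 : ℕ) * ((h₁ l + h₂ l) / (8 * K : ℕ))) ≤ f l := fun {f} h₁f h₂f l => by
    refine natCast_mul_div_mul_le (by norm_num) hK ?_
    calc ((4 : ℕ) : ℝ≥0∞) * (h₁ l + h₂ l) ≤ (4 : ℕ) * (f l + f l) := by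
          gcongr; exacts [h₁f l, h₂f l]
      _ = (8 : ℕ) * f l := by push_cast; ring
  refine ⟨fun l => ratio K * h l, hr.ratio_mul K, fun l => ?_, fun l => ?_, fun l => ?_,
    fun l => ?_⟩
  · exact (hk₁ K hK₁ l).trans (mul_le_mul_right (hc₁h l) _)
  · exact (hk₂ K hK₂ l).trans (mul_le_mul_right (hc₂h l) _)
  · exact ratio_mul_le (h3 l) (hle h₁f h₂f l)
  · exact ratio_mul_le (h4 l) (hle h₁g h₂g l)

theorem exists_isGLB (hS : SatisfiesAxioms S) {D : Set S} (hDc : D.Countable) (hD : IsDense D)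
    {f g : Functional S → ℝ≥0∞} (hf : IsRealified f) (hg : IsRealified g) :
    ∃ i, IsRealified i ∧ i ≤ f ∧ i ≤ g ∧ ∀ h, IsRealified h → h ≤ f → h ≤ g → h ≤ i := by
  set B : Set (Functional S → ℝ≥0∞) :=
    {b | b ∈ basis D ∧ ∃ h, IsRealified h ∧ h ≤ f ∧ h ≤ g ∧ FarBelow b h} with hB
  have hBc : B.Countable := (basis_countable hDc).mono fun b hb => hb.1
  have : Countable B := hBc.to_subtype
  have hne : Nonempty B := by
    obtain ⟨b, hb, -, h⟩ := (farBelow_zero hS.pos (0 : Functional S → ℝ≥0∞)).exists_between_basis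
      hS hD
    exact ⟨b, hb, 0, isRealified_zero, fun _ => zero_le, fun _ => zero_le, h⟩
  have hdir : Directed (· ≤ ·) fun b : B => b.1 := by
    rintro ⟨b₁, hb₁, h₁, hr₁, h₁f, h₁g, hbh₁⟩ ⟨b₂, hb₂, h₂, hr₂, h₂f, h₂g, hbh₂⟩
    obtain ⟨c₁, -, hbc₁, hch₁⟩ := hbh₁.exists_between hS
    obtain ⟨c₂, -, hbc₂, hch₂⟩ := hbh₂.exists_between hS
    obtain ⟨h, hr, hc₁, hc₂, hhf, hhg⟩ := exists_interpolation hS hch₁ hch₂ hf hg hr₁ hr₂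
      h₁f h₁g h₂f h₂g
    obtain ⟨u, hur, hum, huh, hus⟩ := hr.exists_seq hS
    obtain ⟨m, hm⟩ := (hbc₁.mono le_rfl hc₁).exists_le hS hur hum fun l => (hus l).le
    obtain ⟨n, hn⟩ := (hbc₂.mono le_rfl hc₂).exists_le hS hur hum fun l => (hus l).le
    obtain ⟨b, hb, hub, hbh⟩ := (huh (max m n)).exists_between_basis hS hD
    exact ⟨⟨b, hb, h, hr, hhf, hhg, hbh⟩, (hm.trans (hum (le_max_left _ _))).trans hub.le,
      (hn.trans (hum (le_max_right _ _))).trans hub.le⟩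
  refine ⟨fun l => ⨆ b : B, b.1 l,
    (isRealified_iSup_of_directed (fun b : B => exists_frac_of_mem_basis b.2.1) hdir).1,
    fun l => iSup_le ?_, fun l => iSup_le ?_, fun h hr hhf hhg l => ?_⟩
  · rintro ⟨b, -, h, -, hhf, -, hbh⟩
    exact (hbh.le l).trans (hhf l)
  · rintro ⟨b, -, h, -, -, hhg, hbh⟩
    exact (hbh.le l).trans (hhg l)
  · obtain ⟨u, hur, hum, huh, hus⟩ := hr.exists_seq hS
    rw [hus]
    refine iSup_le fun n => ?_
    obtain ⟨b, hb, hub, hbh⟩ := (huh n).exists_between_basis hS hD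
    exact (hub.le l).trans (le_iSup (fun b : B => b.1 l) ⟨b, hb, h, hr, hhf, hhg, hbh⟩)

/-- Approximate compatibility of infima with addition. -/
theorem exists_approx_le_add (hS : SatisfiesAxioms S) {k' k f g h : Functional S → ℝ≥0∞}
    (hk' : FarBelow k' k) (hf : IsRealified f) (hg : IsRealified g)
    (hh : IsRealified h) (hkf : k ≤ f + h) (hkg : k ≤ g + h) {N : ℕ} (hN : 0 < N) :
    ∃ z, IsRealified z ∧ z ≤ g ∧ (∀ l, z l ≤ f l + (2 : ℕ) * (f l / N)) ∧
      ∀ l, k' l ≤ z l + (h l + (4 : ℕ) * (h l / N)) := by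
  obtain ⟨w, hwr, hw0, hww, hwk, hws⟩ := hk'.exists_chain hS hN
  obtain ⟨κ, β, hκr, hβr, hκβ, hκf, -, hβh, hβw⟩ := exists_decomposition hS (hww 1)
    ((hwk 2).le.trans hkf) hf hh
  obtain ⟨β', hβ', hw0β⟩ := (hww 0).exists_approx_left hS (by rwa [add_comm] at hκβ) hβr hκr
  obtain ⟨a, har, ha0, haa, haβ, has⟩ := hβ'.exists_chain hS hN
  obtain ⟨b, hbr, hb1, hb2⟩ := exists_complement hS (haa 0) ((haβ 1).le.trans hβw) (hww 1) (hwr 2)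
  obtain ⟨h', hh', hw2⟩ := (hww 2).exists_approx_left hS
    ((hwk 3).le.trans (hkg.trans_eq (add_comm g h))) hh hg
  obtain ⟨d, hdr, hd1, hd2⟩ := exists_complement hS (haa 0) ((haβ 1).le.trans hβh) hh' hh
  set F : Functional S → ℝ≥0∞ := fun l => f l / N with hF
  set H : Functional S → ℝ≥0∞ := fun l => h l / N with hH
  have hFr : IsRealified F := hf.div hN
  have hHr : IsRealified H := hh.div hN
  have hkFH : ∀ l, k l / N ≤ F l + H l := fun l => by
    simp only [hF, hH, ← ENNReal.add_div]
    exact ENNReal.div_le_div_right (hkf l) _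
  have hw2' : ∀ l, w 2 l ≤ w 0 l + ((F l + H l) + (F l + H l)) := fun l => (hws 2 l).trans (by
    rw [← two_mul]; simpa using add_le_add_right (mul_le_mul_right (hkFH l) 2) _)
  have ha1 : ∀ l, a 1 l ≤ a 0 l + H l := fun l => (has 1 l).trans (by
    simpa using add_le_add_right (ENNReal.div_le_div_right (hβh l) (N : ℝ≥0∞)) _)
  have htop : ∀ l, a 0 l = ⊤ → H l = ⊤ := fun l h1 => by
    have h2 : h l = ⊤ := top_le_iff.1 (h1 ▸ (haβ 0).le.trans hβh l)
    simp only [hH, h2, ENNReal.top_div_of_ne_top (ENNReal.natCast_ne_top N)]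
  have hbf : b ≤ (f + (F + F)) + (H + H) := fun l => by
    refine le_of_add_le_add_of_top (a := a 0 l) ?_ (fun h => by simp [htop l h])
    calc a 0 l + b l ≤ w 2 l := hb1 l
      _ ≤ w 0 l + ((F l + H l) + (F l + H l)) := hw2' l
      _ ≤ (β' l + κ l) + ((F l + H l) + (F l + H l)) := by gcongr; exact hw0β l
      _ ≤ (a 0 l + f l) + ((F l + H l) + (F l + H l)) := by gcongr; exacts [ha0 l, hκf l]
      _ = _ := by simp only [Pi.add_apply]; ring
  have hbg : b ≤ g + (d + H) := fun l => by
    refine le_of_add_le_add_of_top (a := a 0 l) ?_ (fun h => by simp [htop l h])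
    calc a 0 l + b l ≤ w 2 l := hb1 l
      _ ≤ h' l + g l := hw2 l
      _ ≤ (a 1 l + d l) + g l := by gcongr; exact hd2 l
      _ ≤ (a 0 l + H l + d l) + g l := by gcongr; exact ha1 l
      _ = _ := by simp only [Pi.add_apply]; ring
  obtain ⟨b₀, hb₀, hwb₀⟩ := (hww 0).exists_approx_left hS (by rwa [add_comm] at hb2) hbr (har 1)
  obtain ⟨b₁, -, hb₀₁, hb₁⟩ := hb₀.exists_between hS
  obtain ⟨x, y, hxr, hyr, hxy, hxf, hxb, hyH, -⟩ := exists_decomposition hS hb₁ hbf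
    (hf.add (hFr.add hFr)) (hHr.add hHr)
  obtain ⟨x₀, hx₀, hbx₀⟩ := hb₀₁.exists_approx_left hS hxy hxr hyr
  obtain ⟨z, t, hzr, -, hzt, hzg, hzx, htd, -⟩ := exists_decomposition hS hx₀ (hxb.trans hbg) hg
    (hdr.add hHr)
  refine ⟨z, hzr, hzg, fun l => ?_, fun l => ?_⟩
  · calc z l ≤ f l + (F l + F l) := (hzx l).trans (hxf l)
      _ = _ := by push_cast; rw [two_mul]
  · calc k' l ≤ w 0 l := hw0 l
      _ ≤ b₀ l + a 1 l := hwb₀ l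
      _ ≤ (x₀ l + y l) + (a 0 l + H l) := by gcongr; exacts [hbx₀ l, ha1 l]
      _ ≤ ((z l + t l) + (H l + H l)) + (a 0 l + H l) := by gcongr; exacts [hzt l, hyH l]
      _ ≤ ((z l + (d l + H l)) + (H l + H l)) + (a 0 l + H l) := by gcongr; exact htd l
      _ = z l + ((a 0 l + d l) + (4 : ℕ) * H l) := by push_cast; ring
      _ ≤ z l + (h l + (4 : ℕ) * H l) := by gcongr; exact hd1 l

theorem exists_le_add (hS : SatisfiesAxioms S) {k' k f g h : Functional S → ℝ≥0∞}
    (hk' : FarBelow k' k) (hf : IsRealified f) (hg : IsRealified g)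
    (hh : IsRealified h) (hkf : k ≤ f + h) (hkg : k ≤ g + h) :
    ∃ z, IsRealified z ∧ z ≤ f ∧ z ≤ g ∧ k' ≤ z + h := by
  obtain ⟨j, c, hc, hj⟩ := hk'.exists_scaled_of_le
  set K := j + 1
  have hK : 0 < K := by omega
  obtain ⟨z, hzr, hzg, hzf, hcz⟩ := exists_approx_le_add hS hc hf hg hh hkf hkg (N := 4 * K)
    (by positivity)
  refine ⟨fun l => ratio K * z l, hzr.ratio_mul K, fun l => ?_, fun l => ?_, fun l => ?_⟩
  · refine ratio_mul_le (hzf l) (natCast_mul_div_mul_le (by norm_num) hK ?_)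
    gcongr; norm_num
  · calc ratio K * z l ≤ 1 * g l := mul_le_mul' (ratio_le_one K) (hzg l)
      _ = g l := one_mul _
  · calc k' l ≤ ratio K * c l := hj K (Nat.le_succ j) l
      _ ≤ ratio K * (z l + (h l + (4 : ℕ) * (h l / (4 * K : ℕ)))) := by gcongr; exact hcz l
      _ = ratio K * z l + ratio K * (h l + (4 : ℕ) * (h l / (4 * K : ℕ))) := mul_add _ _ _
      _ ≤ ratio K * z l + h l := by
        gcongr
        exact ratio_mul_le le_rfl (natCast_mul_div_mul_le (by norm_num) hK le_rfl)

end Lattice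

end CuSemigroup

theorem theorem4p4 (S : Type*) [AddCommMonoid S] [PartialOrder S] [IsOrderedAddMonoid S]
    (hpos : ∀ s : S, 0 ≤ s)
    (h1 : CuSemigroup.AxiomO1 S) (h2 : CuSemigroup.AxiomO2 S) (h3 : CuSemigroup.AxiomO3 S)
    (h4 : CuSemigroup.AxiomO4 S) (h5 : CuSemigroup.AxiomO5 S) (h6 : CuSemigroup.AxiomO6 S)
    (hD : ∃ D : Set S, D.Countable ∧ CuSemigroup.IsDense D) :
    ∃ inf : CuSemigroup.Realification S → CuSemigroup.Realification S →
        CuSemigroup.Realification S,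
      (∀ f g, IsGLB {f, g} (inf f g)) ∧
      (∀ (f : CuSemigroup.Realification S) (g : ℕ → CuSemigroup.Realification S), Monotone g →
        ∃ s : CuSemigroup.Realification S, IsLUB (Set.range g) s ∧
          IsLUB (Set.range fun n => inf f (g n)) (inf f s)) ∧
      (∀ f g h, inf f g + h = inf (f + h) (g + h)) := by
  have hS : CuSemigroup.SatisfiesAxioms S := ⟨hpos, h1, h2, h3, h4, h5, h6⟩
  obtain ⟨D, hDc, hDd⟩ := hD
  choose i hir hif hig hi using fun f g : CuSemigroup.Realification S =>
    CuSemigroup.exists_isGLB hS hDc hDd f.2 g.2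
  have hle : ∀ {f g h : CuSemigroup.Realification S}, h ≤ f → h ≤ g → h ≤ ⟨i f g, hir f g⟩ :=
    fun {f g h} hf hg => hi f g h h.2 hf hg
  refine ⟨fun f g => ⟨i f g, hir f g⟩, fun f g => ⟨?_, fun h hh => ?_⟩, fun f g hg => ?_,
    fun f g h => le_antisymm (hle ?_ ?_) ?_⟩
  · rintro _ (rfl | rfl)
    exacts [hif _ _, hig _ _]
  · exact hle (hh (Or.inl rfl)) (hh (Or.inr rfl))
  · have hgm : Monotone fun n => (g n).1 := fun a b hab => hg hab
    set s : CuSemigroup.Realification S := ⟨fun l => ⨆ n, (g n).1 l,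
      CuSemigroup.isRealified_iSup hS (fun n => (g n).2) hgm⟩ with hs
    have hgs : ∀ n, g n ≤ s := fun n l => le_iSup (fun n => (g n).1 l) n
    refine ⟨s, ⟨?_, fun t ht l => iSup_le fun n => ht ⟨n, rfl⟩ l⟩, ?_, fun t ht => ?_⟩
    · rintro _ ⟨n, rfl⟩
      exact hgs n
    · rintro _ ⟨n, rfl⟩
      exact hle (hif f (g n)) (show (⟨i f (g n), hir f (g n)⟩ : CuSemigroup.Realification S) ≤ s
        from le_trans (hig f (g n)) (hgs n))
    · obtain ⟨u, hur, -, hui, hus⟩ := CuSemigroup.IsRealified.exists_seq hS (hir f s)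
      intro l
      change i f s l ≤ _
      rw [hus]
      refine iSup_le fun m => ?_
      obtain ⟨n, hn⟩ := (hui m).exists_le hS (fun n => (g n).2) hgm (fun l => hig f s l)
      have h7 : u m ≤ i f (g n) := hi f (g n) (u m) (hur m) ((hui m).le.trans (hif f s)) hn
      exact (h7 l).trans (ht ⟨n, rfl⟩ l)
  · exact add_le_add_left (show (⟨i f g, hir f g⟩ : CuSemigroup.Realification S) ≤ f from hif f g) h
  · exact add_le_add_left (show (⟨i f g, hir f g⟩ : CuSemigroup.Realification S) ≤ g from hig f g) h
  · obtain ⟨u, -, -, hui, hus⟩ := CuSemigroup.IsRealified.exists_seq hS (hir (f + h) (g + h))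
    intro l
    change i (f + h) (g + h) l ≤ i f g l + h.1 l
    rw [hus]
    refine iSup_le fun n => ?_
    obtain ⟨z, hzr, hzf, hzg, hz⟩ := CuSemigroup.exists_le_add hS (hui n) f.2 g.2 h.2
      (hif (f + h) (g + h)) (hig (f + h) (g + h))
    exact (hz l).trans (add_le_add_left (hi f g z hzr hzf hzg l) _)
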